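/- Let $0<R<\infty$, let $f$ be meromorphic in $D(0,R)=\{z\in\mathbb{C}:|z|<R\}$, and let $j,k$ be integers with $k>j\ge 0$ such that $f^{(j)}\not\equiv 0$. Let $s:[0,R)\to[0,R)$ be increasing and continuous, with $s(r)\in(r,R)$ for all $r\in[0,R)$ and with $s(r)-r$ decreasing (both monotonicities in the non-strict sense). Let $\delta\in(0,1)$. Write $T(r,f)=m(r,f)+N(r,f)$, $0<r<R$, for the Nevanlinna characteristic, where $$m(r,f)=\frac1{2\pi}\int_0^{2\pi}\log^+|f(re^{i\theta})|\,d\theta,\qquad N(r,f)=\int_0^r\frac{n(t,f)-n(0,f)}{t}\,dt+n(0,f)\log r,$$ and $n(t,f)$ is the number of poles of $f$ in $|z|\le t$, counted with multiplicity. Then there is a measurable set $E\subset[0,R)$ with $$\overline{d}(E)=\limsup_{r\to R^-}\frac{m(E\cap[r,R))}{R-r}\le\delta,$$ where $m$ of a set denotes Lebesgue measure, such that the following hold. (1) There is a constant $C>0$, independent of $r$, such that for all $r\in[0,R)\setminus E$ the integral on the left converges and $$\int_0^{2\pi}\left|\frac{f^{(k)}(re^{i\theta})}{f^{(j)}(re^{i\theta})}\right|^{\frac1{k-j}}d\theta\le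 C\,\frac{T(s(r),f)-\log(s(r)-r)}{s(r)-r}.$$ (2) If $k=1$ and $j=0$, then the logarithmic term can be dropped, up to an additive constant: there is a constant $C>0$, independent of $r$, such that for all $r\in[0,R)\setminus E$ the integral on the left converges and $$\int_0^{2\pi}\left|\frac{f'(re^{i\theta})}{f(re^{i\theta})}\right|d\theta\le C\,\frac{T(s(r),f)+C}{s(r)-r}.$$ If moreover $T(r_0,f)>0$ for some $r_0\in(0,R)$, then there is a constant $C>0$, independent of $r$, such that for all $r\in[0,R)\setminus E$ $$\int_0^{2\pi}\left|\frac{f'(re^{i\theta})}{f(re^{i\theta})}\right|d\theta\le C\,\frac{T(s(r),f)}{s(r)-r}.$$ -/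

import Mathlib

open Set Filter Topology MeasureTheory

noncomputable section

/-- The integrated counting function of poles of a function `f` that is meromorphic on a
neighbourhood of the closed disc `|z| ≤ r`, where `r > 0`:
`N(r, f) = ∑_{0 < |b| ≤ r} log (r / |b|) + n(0, f) log r`, where `b` runs over the poles of `f`,
counted with multiplicity, and `n(0, f)` is the multiplicity of the pole at the origin.
This is the value of `∫_0^r (n(t, f) - n(0, f)) / t dt + n(0, f) log r`.
(The summand at `b = 0` vanishes, because `log (r * ‖0‖⁻¹) = log 0 = 0` in Lean. The only
difference from `ValueDistribution.logCounting f ⊤` is that `f` need not be meromorphic on all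
of the complex plane.) -/
def poleCounting (f : ℂ → ℂ) (r : ℝ) : ℝ :=
  ∑ᶠ z : ℂ, ((MeromorphicOn.divisor f (Metric.closedBall 0 |r|))⁻ z : ℝ) * Real.log (r * ‖z‖⁻¹)
    + ((MeromorphicOn.divisor f (Metric.closedBall 0 |r|))⁻ 0 : ℝ) * Real.log r

/-- The Nevanlinna characteristic `T(r, f) = m(r, f) + N(r, f)`, where
`m(r, f) = (1 / 2π) ∫_0^{2π} log⁺ |f(r e^{iθ})| dθ`. -/
def nevanlinnaT (f : ℂ → ℂ) (r : ℝ) : ℝ :=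
  ValueDistribution.proximity f ⊤ r + poleCounting f r

/-- The upper density near `R` of a set `E ⊆ [0, R)`:
`limsup_{r → R⁻} m(E ∩ [r, R)) / (R - r)`. -/
def upperDensityNear (R : ℝ) (E : Set ℝ) : ENNReal :=
  limsup (fun r : ℝ => volume (E ∩ Ico r R) / ENNReal.ofReal (R - r)) (𝓝[<] R)

/-- `∫_0^{2π} |f^{(k)}(r e^{iθ}) / f^{(j)}(r e^{iθ})|^{1/(k-j)} dθ` converges and is at most `B`. -/
def LogDerivMeanLE (f : ℂ → ℂ) (j k : ℕ) (r B : ℝ) : Prop :=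
  IntervalIntegrable (fun θ : ℝ =>
      ‖iteratedDeriv k f (circleMap 0 r θ) / iteratedDeriv j f (circleMap 0 r θ)‖
        ^ (1 / ((k : ℝ) - (j : ℝ)))) volume 0 (2 * Real.pi) ∧
    ∫ θ in (0 : ℝ)..(2 * Real.pi),
      ‖iteratedDeriv k f (circleMap 0 r θ) / iteratedDeriv j f (circleMap 0 r θ)‖
        ^ (1 / ((k : ℝ) - (j : ℝ))) ≤ B

end

/-!
The estimate is first proved for area integrals, where it holds without an exceptional set, and is
then transferred to single circles by Markov's inequality.

*Local formula.* If `g` has no zeros in the closed disc of centre `c` and radius `t`, then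
`g' / g` at `c` is twice the first Fourier coefficient of `log ‖g‖` on the circle, divided by `t`
(`fourierCoeffOne_log_norm`). After splitting off zeros and poles this bounds `‖f' / f‖` at almost
every `c` by `1 / (π t)` times the integral of `|log ‖f‖|` over the circle, plus the sum of
`1 / ‖c - a‖` over the zeros and poles `a` with `‖c - a‖ < t` (`ae_enorm_logDeriv_le`).

*Area bound.* Take `t` comparable to `h` and integrate over the annulus `r ≤ ‖c‖ ≤ r + h / 4`.
By Fubini the first term is at most the integral of `|log ‖f‖|` over a slightly wider annulus,
divided by `t`, hence of order `T(r + h, f)`, since the annulus has width of order `h`. In the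
second, each kernel `1 / ‖c - a‖` has integral `2 π t`, and Jensen's formula bounds the number of
zeros and poles by `T(r + h, f) / h`. Together the area integral of `f' / f` is
`O(T(r + h, f) + 1)`, with no logarithmic term (`exists_setLIntegral_logDeriv_le`). That `T` is
increasing follows from Cartan's identity (`nevanlinnaT_mono`).

*Higher derivatives.* At a good radius in `[r, r + h / 4]` the mean of `‖f' / f‖` is
`O((T(r + h, f) + 1) / h)`, so by concavity of the logarithm
`T(r, f') = O(T(r + h, f) + log (R / h) + 1)` (`exists_nevanlinnaT_deriv_le`). Induction gives the
area bound for the logarithmic derivative of each `f⁽ⁱ⁾`. Since `f⁽ᵏ⁾ / f⁽ʲ⁾` is a product of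
`k - j` of these, its power `1 / (k - j)` is at most their sum
(`exists_setLIntegral_quotientMean_le`).

*Exceptional set.* Partition `[r₂, R)` by `qₙ₊₁ = qₙ + (s qₙ - qₙ) / 8`. On each interval the
circular mean exceeds `2 / δ` times its average over the interval only on a subset of relative
measure at most `δ / 2`, and the union of these subsets, with `[0, r₂)`, has upper density at most
`δ` (`exists_upperDensityNear_le`). At the other radii `r` of the interval the area bound with
`h = s qₙ - qₙ` applies, and `T(s qₙ, f) ≤ T(s r, f)` and `s r - r ≤ s qₙ - qₙ` because `s` is
increasing and `s r - r` is decreasing.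

The function `f` may take arbitrary values outside the disc. It is therefore replaced by its
extension by zero, which is measurable.
-/

section

open Real Metric ComplexConjugate

/-! ### The first Fourier coefficient of `log ‖f‖` on a circle -/

/-- A zero-free analytic function near a closed disc has an analytic logarithm there. -/
lemma AnalyticOnNhd.exists_log_of_closedBall {g : ℂ → ℂ} {c : ℂ} {t : ℝ} (ht : 0 < t)
    (hg : AnalyticOnNhd ℂ g (closedBall c t)) (hg0 : ∀ z ∈ closedBall c t, g z ≠ 0) :
    ∃ t' > t, ∃ G : ℂ → ℂ, DifferentiableOn ℂ G (ball c t') ∧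
      (∀ z ∈ ball c t', g z = Complex.exp (G z)) ∧ deriv G c = logDeriv g c := by
  obtain ⟨δ, hδ, hsub⟩ := (isCompact_closedBall c t).exists_thickening_subset_open
    (t := {z | AnalyticAt ℂ g z ∧ g z ≠ 0}) (by
      rw [isOpen_iff_mem_nhds]
      rintro z ⟨hz, hz0⟩
      exact hz.eventually_analyticAt.and (hz.continuousAt.eventually_ne hz0))
    (fun z hz => ⟨hg z hz, hg0 z hz⟩)
  rw [thickening_closedBall hδ ht.le] at hsub
  have hgd : DifferentiableOn ℂ g (ball c (δ + t)) :=
    fun z hz => (hsub hz).1.differentiableAt.differentiableWithinAt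
  have hld : DifferentiableOn ℂ (logDeriv g) (ball c (δ + t)) :=
    fun z hz =>
      ((hsub hz).1.deriv.div (hsub hz).1 (hsub hz).2).differentiableAt.differentiableWithinAt
  obtain ⟨H, hH⟩ := hld.isExactOn_ball
  have hc : c ∈ ball c (δ + t) := mem_ball_self (by positivity)
  have hconst : ∀ z ∈ ball c (δ + t),
      g z * Complex.exp (-H z) = g c * Complex.exp (-H c) := by
    intro z hz
    refine isOpen_ball.is_const_of_deriv_eq_zero (f := fun z => g z * Complex.exp (-H z))
      (convex_ball c (δ + t)).isPreconnected ?_ ?_ hz hc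
    · intro w hw
      exact (((hsub hw).1.differentiableAt.hasDerivAt.mul
        ((hH w hw).neg.cexp))).differentiableAt.differentiableWithinAt
    · intro w hw
      have hd : HasDerivAt (fun z => g z * Complex.exp (-H z)) _ w :=
        (hsub hw).1.differentiableAt.hasDerivAt.mul (hH w hw).neg.cexp
      have := (hsub hw).2
      rw [hd.deriv]
      simp only [logDeriv_apply, Pi.zero_apply, Pi.neg_apply]
      field_simp
      ring
  refine ⟨δ + t, by linarith, fun z => H z + (Complex.log (g c) - H c), ?_, ?_, ?_⟩
  · exact fun z hz => ((hH z hz).add_const _).differentiableAt.differentiableWithinAt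
  · intro z hz
    have h1 := hconst z hz
    have h2 := (hsub hc).2
    rw [Complex.exp_add, Complex.exp_sub, Complex.exp_log h2]
    rw [Complex.exp_neg, Complex.exp_neg] at h1
    have h3 := Complex.exp_ne_zero (H z)
    have h4 := Complex.exp_ne_zero (H c)
    field_simp at h1 ⊢
    linear_combination h1
  · rw [((hH c hc).add_const _).deriv]

/-- For `G` analytic near a closed disc, the derivative at the centre is twice the first Fourier
coefficient of the real part of `G` on the boundary circle. -/
lemma deriv_eq_circleAverage_re {G : ℂ → ℂ} {c : ℂ} {t t' : ℝ} (ht : 0 < t) (htt : t < t')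
    (hG : DifferentiableOn ℂ G (ball c t')) :
    deriv G c = 2 * circleAverage (fun w => ((G w).re : ℂ) * (w - c)⁻¹) c t := by
  have hsub : closedBall c t ⊆ ball c t' := closedBall_subset_ball htt
  have hsph : sphere c |t| ⊆ closedBall c t := by
    rw [abs_of_pos ht]; exact sphere_subset_closedBall
  have hne : ∀ w ∈ sphere c |t|, w - c ≠ 0 := by
    intro w hw h
    rw [mem_sphere, dist_eq_norm, h, norm_zero, abs_of_pos ht] at hw
    exact ht.ne hw
  have hGc : ContinuousOn G (sphere c |t|) := hG.continuousOn.mono (hsph.trans hsub)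
  have hinv : ContinuousOn (fun w => (w - c)⁻¹) (sphere c |t|) :=
    (by fun_prop : ContinuousOn (fun w => w - c) (sphere c |t|)).inv₀ hne
  have h1 : circleAverage (fun w => G w * (w - c)⁻¹) c t = deriv G c := by
    rw [circleAverage_eq_circleIntegral ht.ne',
      ← Complex.two_pi_I_inv_smul_circleIntegral_sub_sq_inv_smul_of_differentiable isOpen_ball
        hsub hG (mem_ball_self ht)]
    congr 1
    apply circleIntegral.integral_congr ht.le
    intro w _
    simp only [smul_eq_mul]
    rw [← inv_pow]
    ring
  have h2 : circleAverage (fun w => G w * (w - c)) c t = 0 := by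
    have hd : DifferentiableOn ℂ (fun w => G w * (w - c)) (ball c t') := hG.mul (by fun_prop)
    rw [DiffContOnCl.circleAverage]
    · simp
    · rw [abs_of_pos ht]
      exact hd.diffContOnCl_ball hsub
  have h3 : circleAverage (fun w => conj (G w) * (w - c)⁻¹) c t = 0 := by
    have : circleAverage (fun w => conj (G w) * (w - c)⁻¹) c t
        = circleAverage (fun w => ((t : ℂ) ^ 2)⁻¹ • Complex.conjCLE (G w * (w - c))) c t := by
      apply circleAverage_congr_sphere
      intro w hw
      have hw0 := hne w hw
      have hw' : (w - c) * conj (w - c) = (t : ℂ) ^ 2 := by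
        rw [Complex.mul_conj, Complex.normSq_eq_norm_sq]
        rw [mem_sphere, dist_eq_norm, abs_of_pos ht] at hw
        rw [hw]; push_cast; rfl
      have ht0 : (t : ℂ) ^ 2 ≠ 0 := by
        have : (t : ℂ) ≠ 0 := by exact_mod_cast ht.ne'
        positivity
      simp only [Complex.conjCLE_apply, map_mul, smul_eq_mul]
      rw [← hw']
      have hcw : conj (w - c) ≠ 0 := (map_ne_zero _).2 hw0
      field_simp
    rw [this, circleAverage_fun_smul]
    have h4 := ContinuousLinearMap.circleAverage_comp_comm
      (Complex.conjCLE : ℂ ≃L[ℝ] ℂ).toContinuousLinearMap (f := fun w => G w * (w - c))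
      (c := c) (R := t) (ContinuousOn.circleIntegrable' (hGc.mul (by fun_prop)))
    rw [h2, map_zero] at h4
    have h5 : circleAverage (fun w => Complex.conjCLE (G w * (w - c))) c t = 0 := h4
    rw [h5, smul_zero]
  have h6 : circleAverage (fun w => ((G w).re : ℂ) * (w - c)⁻¹) c t
      = circleAverage (fun w => (2⁻¹ : ℂ) • (G w * (w - c)⁻¹ + conj (G w) * (w - c)⁻¹)) c t := by
    congr 1
    ext w
    rw [Complex.re_eq_add_conj, smul_eq_mul]
    ring
  rw [h6, circleAverage_fun_smul, circleAverage_fun_add, h1, h3]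
  · simp
  · exact ContinuousOn.circleIntegrable' (hGc.mul hinv)
  · exact ContinuousOn.circleIntegrable' ((Complex.continuous_conj.comp_continuousOn hGc).mul hinv)

/-- Twice the first Fourier coefficient, divided by the radius, of a real function `u` on the
circle of centre `c` and radius `t`. -/
noncomputable def fourierCoeffOne (u : ℂ → ℝ) (c : ℂ) (t : ℝ) : ℂ :=
  2 * circleAverage (fun w => (u w : ℂ) * (w - c)⁻¹) c t

lemma fourierCoeffOne_log_norm {g : ℂ → ℂ} {c : ℂ} {t : ℝ} (ht : 0 < t)
    (hg : AnalyticOnNhd ℂ g (closedBall c t)) (hg0 : ∀ z ∈ closedBall c t, g z ≠ 0) :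
    fourierCoeffOne (fun w => log ‖g w‖) c t = logDeriv g c := by
  obtain ⟨t', htt, G, hG, hexp, hd⟩ := hg.exists_log_of_closedBall ht hg0
  rw [← hd, deriv_eq_circleAverage_re ht htt hG, fourierCoeffOne]
  congr 1
  apply circleAverage_congr_sphere
  intro w hw
  have hw' : w ∈ ball c t' := by
    rw [abs_of_pos ht] at hw
    exact closedBall_subset_ball htt (sphere_subset_closedBall hw)
  simp only
  rw [hexp w hw', Complex.norm_exp, Real.log_exp]

lemma fourierCoeffOne_log_norm_sub_of_lt {a c : ℂ} {t : ℝ} (ht : 0 < t) (h : t < ‖c - a‖) :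
    fourierCoeffOne (fun w => log ‖w - a‖) c t = (c - a)⁻¹ := by
  rw [fourierCoeffOne_log_norm ht (g := fun w => w - a)]
  · simp [logDeriv_apply]
  · exact fun z _ => by fun_prop
  · intro z hz h0
    rw [sub_eq_zero] at h0
    rw [h0, mem_closedBall, dist_comm, dist_eq_norm] at hz
    linarith

/-- For a zero inside the circle, `w - a` may be replaced by its reflection, which has the same
modulus on the circle up to a constant factor and no zero in the disc. -/
lemma fourierCoeffOne_log_norm_sub_of_gt {a c : ℂ} {t : ℝ} (ht : 0 < t) (h : ‖c - a‖ < t) :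
    fourierCoeffOne (fun w => log ‖w - a‖) c t = conj (c - a) / (t : ℂ) ^ 2 := by
  have ht0 : (t : ℂ) ≠ 0 := by exact_mod_cast ht.ne'
  have h1 := fourierCoeffOne_log_norm (c := c) ht
    (g := fun w => ((t : ℂ) ^ 2 + conj (c - a) * (w - c)) * (t : ℂ)⁻¹)
    (fun z _ => by fun_prop) (by
      intro z hz h0
      rw [mul_eq_zero, or_iff_left (inv_ne_zero ht0)] at h0
      rw [mem_closedBall, dist_eq_norm] at hz
      have h2 : ‖(t : ℂ) ^ 2‖ = ‖conj (c - a) * (z - c)‖ := by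
        rw [eq_neg_of_add_eq_zero_left h0, norm_neg]
      rw [norm_mul, RCLike.norm_conj, norm_pow, Complex.norm_real, norm_of_nonneg ht.le] at h2
      nlinarith [norm_nonneg (c - a), norm_nonneg (z - c)])
  have h3 : logDeriv (fun w => ((t : ℂ) ^ 2 + conj (c - a) * (w - c)) * (t : ℂ)⁻¹) c
      = conj (c - a) / (t : ℂ) ^ 2 := by
    have hd : HasDerivAt (fun w => ((t : ℂ) ^ 2 + conj (c - a) * (w - c)) * (t : ℂ)⁻¹)
        ((conj (c - a) * 1) * (t : ℂ)⁻¹) c :=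
      (((((hasDerivAt_id c).sub_const c).const_mul (conj (c - a))).const_add _).mul_const _)
    rw [logDeriv_apply, hd.deriv]
    simp only [sub_self, mul_zero, add_zero]
    field_simp
  rw [← h3, ← h1, fourierCoeffOne, fourierCoeffOne]
  congr 1
  apply circleAverage_congr_sphere
  intro w hw
  rw [mem_sphere, dist_eq_norm, abs_of_pos ht] at hw
  have h4 : (w - c) * conj (w - c) = (t : ℂ) ^ 2 := by
    rw [Complex.mul_conj, Complex.normSq_eq_norm_sq, hw]; push_cast; rfl
  have h5 : (t : ℂ) ^ 2 + conj (c - a) * (w - c) = (w - c) * conj (w - a) := by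
    rw [← h4]; simp only [map_sub]; ring
  simp only
  rw [h5, norm_mul, norm_mul, RCLike.norm_conj, hw, norm_inv, Complex.norm_real,
    norm_of_nonneg ht.le]
  congr 3
  field_simp

lemma CircleIntegrable.ofReal_mul_inv_sub {u : ℂ → ℝ} {c : ℂ} {t : ℝ} (ht : 0 < t)
    (hu : CircleIntegrable u c t) :
    CircleIntegrable (fun w => (u w : ℂ) * (w - c)⁻¹) c t := by
  have h1 : IntervalIntegrable (fun θ => ((u (circleMap c t θ) : ℝ) : ℂ)) volume 0 (2 * π) := by
    rw [CircleIntegrable, intervalIntegrable_iff] at hu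
    rw [intervalIntegrable_iff]
    exact hu.ofReal
  refine IntervalIntegrable.mul_continuousOn h1 ?_
  apply ContinuousOn.inv₀ (by fun_prop)
  intro θ _
  simp [circleMap, ht.ne']

lemma fourierCoeffOne_add {u v : ℂ → ℝ} {c : ℂ} {t : ℝ} (ht : 0 < t)
    (hu : CircleIntegrable u c t) (hv : CircleIntegrable v c t) :
    fourierCoeffOne (fun w => u w + v w) c t
      = fourierCoeffOne u c t + fourierCoeffOne v c t := by
  rw [fourierCoeffOne, fourierCoeffOne, fourierCoeffOne, ← mul_add,
    ← circleAverage_fun_add (hu.ofReal_mul_inv_sub ht) (hv.ofReal_mul_inv_sub ht)]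
  simp only [Complex.ofReal_add, add_mul]

lemma fourierCoeffOne_sum {ι : Type*} (S : Finset ι) {n : ι → ℝ} {u : ι → ℂ → ℝ} {c : ℂ} {t : ℝ}
    (ht : 0 < t) (hu : ∀ i ∈ S, CircleIntegrable (u i) c t) :
    fourierCoeffOne (fun w => ∑ i ∈ S, n i * u i w) c t
      = ∑ i ∈ S, n i * fourierCoeffOne (u i) c t := by
  have h1 : (fun w => ((∑ i ∈ S, n i * u i w : ℝ) : ℂ) * (w - c)⁻¹)
      = fun w => ∑ i ∈ S, (n i : ℂ) • ((u i w : ℂ) * (w - c)⁻¹) := by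
    ext w
    push_cast
    rw [Finset.sum_mul]
    simp only [smul_eq_mul, mul_assoc]
  rw [fourierCoeffOne, h1, circleAverage_fun_sum, Finset.mul_sum]
  · refine Finset.sum_congr rfl fun i _ => ?_
    rw [circleAverage_fun_smul, fourierCoeffOne, smul_eq_mul]
    ring
  · intro i hi
    exact IntervalIntegrable.const_mul ((hu i hi).ofReal_mul_inv_sub ht) _

lemma enorm_fourierCoeffOne_le (u : ℂ → ℝ) (c : ℂ) {t : ℝ} (ht : 0 < t) :
    ‖fourierCoeffOne u c t‖ₑ ≤ ENNReal.ofReal (1 / (π * t)) *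
      ∫⁻ θ in Ioc 0 (2 * π), ‖u (circleMap c t θ)‖ₑ := by
  have h1 : ‖∫ θ in (0 : ℝ)..2 * π, (u (circleMap c t θ) : ℂ) * (circleMap c t θ - c)⁻¹‖ₑ
      ≤ ENNReal.ofReal (1 / t) * ∫⁻ θ in Ioc 0 (2 * π), ‖u (circleMap c t θ)‖ₑ := by
    rw [intervalIntegral.integral_of_le (by positivity)]
    refine (enorm_integral_le_lintegral_enorm _).trans ?_
    rw [← lintegral_const_mul' _ _ ENNReal.ofReal_ne_top]
    refine lintegral_mono fun θ => ?_
    have h2 : ‖(circleMap c t θ - c)⁻¹‖ₑ = ENNReal.ofReal (1 / t) := by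
      rw [← ofReal_norm]
      simp [circleMap, abs_of_pos ht]
    rw [enorm_mul, h2, mul_comm]
    gcongr
    rw [← ofReal_norm, ← ofReal_norm, Complex.norm_real]
  rw [fourierCoeffOne, circleAverage_def, enorm_mul, enorm_smul]
  refine (mul_le_mul_right (mul_le_mul_right h1 _) _).trans (le_of_eq ?_)
  rw [← mul_assoc, ← mul_assoc]
  congr 1
  rw [← ofReal_norm, ← ofReal_norm, ← ENNReal.ofReal_mul (norm_nonneg _),
    ← ENNReal.ofReal_mul (by positivity)]
  congr 1
  rw [Real.norm_of_nonneg (by positivity)]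
  simp
  field_simp

/-! ### The differentiated Poisson–Jensen formula -/

lemma fourierCoeffOne_congr {u v : ℂ → ℝ} {c : ℂ} {t : ℝ} (ht : 0 < t)
    (h : u =ᶠ[codiscreteWithin (sphere c |t|)] v) :
    fourierCoeffOne u c t = fourierCoeffOne v c t := by
  rw [fourierCoeffOne, fourierCoeffOne]
  congr 1
  refine circleAverage_congr_codiscreteWithin ?_ ht.ne'
  filter_upwards [h] with w hw
  rw [hw]

/-- The differentiated Poisson–Jensen formula at the centre of a circle that carries no zeros or
poles. -/
lemma logDeriv_eq_fourierCoeffOne_add_sum {f g : ℂ → ℂ} {c : ℂ} {t : ℝ} {D : ℂ → ℤ}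
    {S : Finset ℂ} (ht : 0 < t)
    (hg : AnalyticOnNhd ℂ g (closedBall c t)) (hg0 : ∀ z ∈ closedBall c t, g z ≠ 0)
    (hlog : (fun w => log ‖f w‖) =ᶠ[codiscreteWithin (sphere c |t|)]
      fun w => ∑ a ∈ S, (D a : ℝ) * log ‖w - a‖ + log ‖g w‖)
    (hld : logDeriv f c = ∑ a ∈ S, (D a : ℂ) * (c - a)⁻¹ + logDeriv g c)
    (hS : ∀ a ∈ S, ‖c - a‖ ≠ t) :
    logDeriv f c = fourierCoeffOne (fun w => log ‖f w‖) c t +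
      ∑ a ∈ S, (D a : ℂ) *
        (if ‖c - a‖ < t then (c - a)⁻¹ - conj (c - a) / (t : ℂ) ^ 2 else 0) := by
  have h1 : fourierCoeffOne (fun w => log ‖f w‖) c t
      = ∑ a ∈ S, (D a : ℂ) *
        (if ‖c - a‖ < t then conj (c - a) / (t : ℂ) ^ 2 else (c - a)⁻¹) + logDeriv g c := by
    have hi : ∀ a ∈ S, CircleIntegrable (fun w => log ‖w - a‖) c t :=
      fun a _ => circleIntegrable_log_norm_sub_const t
    rw [fourierCoeffOne_congr ht hlog, fourierCoeffOne_add ht,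
      fourierCoeffOne_sum S ht hi, fourierCoeffOne_log_norm ht hg hg0]
    · congr 1
      refine Finset.sum_congr rfl fun a ha => ?_
      rw [Complex.ofReal_intCast]
      congr 1
      split_ifs with h
      · exact fourierCoeffOne_log_norm_sub_of_gt ht h
      · exact fourierCoeffOne_log_norm_sub_of_lt ht (lt_of_le_of_ne (not_lt.1 h) (hS a ha).symm)
    · refine CircleIntegrable.fun_sum S fun a ha => ?_
      exact IntervalIntegrable.const_mul (hi a ha) _
    · apply MeromorphicOn.circleIntegrable_log_norm
      rw [abs_of_pos ht]
      exact (hg.mono sphere_subset_closedBall).meromorphicOn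
  rw [h1, hld, add_right_comm, ← Finset.sum_add_distrib]
  congr 1
  refine Finset.sum_congr rfl fun a _ => ?_
  split_ifs <;> ring

lemma norm_inv_sub_conj_div_le {w : ℂ} {t : ℝ} (h : ‖w‖ < t) :
    ‖w⁻¹ - conj w / (t : ℂ) ^ 2‖ ≤ ‖w‖⁻¹ := by
  rcases eq_or_ne w 0 with rfl | hw
  · simp
  have ht : 0 < t := (norm_nonneg w).trans_lt h
  have ht0 : (t : ℂ) ≠ 0 := by exact_mod_cast ht.ne'
  have h1 : w⁻¹ - conj w / (t : ℂ) ^ 2 = ((1 - ‖w‖ ^ 2 / t ^ 2 : ℝ) : ℂ) * w⁻¹ := by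
    have h2 : w * conj w = ((‖w‖ ^ 2 : ℝ) : ℂ) := by
      rw [Complex.mul_conj, Complex.normSq_eq_norm_sq]
    push_cast at h2 ⊢
    rw [← h2]
    field_simp
  have h3 : 0 ≤ ‖w‖ ^ 2 / t ^ 2 := by positivity
  have h4 : ‖w‖ ^ 2 / t ^ 2 ≤ 1 := by
    rw [div_le_one (by positivity)]
    gcongr
  rw [h1, norm_mul, Complex.norm_real, norm_inv, Real.norm_of_nonneg (by linarith)]
  exact mul_le_of_le_one_left (by positivity) (by linarith)

/-- Local bound for the logarithmic derivative: at almost every point `c`, only the mean of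
`|log ‖f‖|` over a small circle about `c` and the zeros and poles inside that circle
contribute. -/
lemma ae_enorm_logDeriv_le {f : ℂ → ℂ} {ρ t : ℝ} (hf : MeromorphicOn f (closedBall 0 ρ))
    (hord : ∀ u ∈ closedBall (0 : ℂ) ρ, meromorphicOrderAt f u ≠ ⊤) (ht : 0 < t)
    {S : Finset ℂ} (hS : (MeromorphicOn.divisor f (closedBall 0 ρ)).support ⊆ S) :
    ∀ᵐ c ∂volume, closedBall c t ⊆ closedBall 0 ρ →
      ‖logDeriv f c‖ₑ ≤ ENNReal.ofReal (1 / (π * t)) *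
          (∫⁻ θ in Ioc 0 (2 * π), ‖log ‖f (circleMap c t θ)‖‖ₑ) +
        ∑ a ∈ S, ‖(MeromorphicOn.divisor f (closedBall 0 ρ) a : ℝ)‖ₑ *
          (ball a t).indicator (fun z => ‖z - a‖ₑ⁻¹) c := by
  set U := closedBall (0 : ℂ) ρ
  set D := MeromorphicOn.divisor f U with hD
  have hfin : D.support.Finite := D.finiteSupport (isCompact_closedBall 0 ρ)
  obtain ⟨g, hg, hg0, hfg⟩ := hf.extract_zeros_poles (fun u => hord u u.2) hfin
  rw [← hD] at hfg
  have hsub : ∀ a : ℂ, MeromorphicOn (fun z => z - a) U := fun a z _ => by fun_prop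
  have hsub' : ∀ a : ℂ, ∀ z ∈ U, meromorphicOrderAt (fun z : ℂ => z - a) z ≠ ⊤ := by
    intro a z _
    rw [meromorphicOrderAt_ne_top_iff_eventually_ne_zero (by fun_prop)]
    have : ∀ᶠ x in 𝓝[≠] z, x ≠ a := by
      rcases eq_or_ne z a with rfl | h
      · exact eventually_mem_nhdsWithin
      · exact (continuousAt_id.eventually_ne h).filter_mono nhdsWithin_le_nhds
    filter_upwards [this] with x hx using sub_ne_zero.2 hx
  have hPord : ∀ x ∈ U, meromorphicOrderAt (∏ᶠ u, (· - u) ^ D u) x ≠ ⊤ :=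
    fun x _ => Function.FactorizedRational.meromorphicOrderAt_ne_top D
  have hgord : ∀ x ∈ U, meromorphicOrderAt g x ≠ ⊤ := by
    intro x hx
    rw [(hg x hx).meromorphicOrderAt_eq, (hg x hx).analyticOrderAt_eq_zero.2 (hg0 ⟨x, hx⟩)]
    simp
  have hl1 :=
    (Function.FactorizedRational.meromorphicNFOn D U).meromorphicOn.logDeriv_mul_eventuallyEq
    hg.meromorphicOn hPord hgord
  have hl2 := MeromorphicOn.logDeriv_finprod_zpow_eventuallyEq (U := U) hfin hsub hsub'
  have hlog := MeromorphicOn.extract_zeros_poles_log hg0 hfg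
  have hsumEq : ∀ w : ℂ, (∑ᶠ u, (D u * log ‖· - u‖) : ℂ → ℝ) w
      = ∑ a ∈ S, (D a : ℝ) * log ‖w - a‖ := by
    intro w
    rw [finsum_eq_sum_of_support_subset (s := S), Finset.sum_apply]
    · refine Subset.trans (fun u hu => ?_) hS
      rw [Function.mem_support] at hu ⊢
      contrapose! hu
      ext w
      simp [hu]
  have hUm : MeasurableSet U := measurableSet_closedBall
  have hae := fun (p : ℂ → Prop) (h : ∀ᶠ c in codiscreteWithin U, p c) =>
    (ae_restrict_iff' hUm).1 (ae_restrict_le_codiscreteWithin (μ := volume) hUm h)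
  have hsph : ∀ᵐ c ∂(volume : Measure ℂ), ∀ a ∈ S, ‖c - a‖ ≠ t := by
    rw [Finset.eventually_all]
    intro a _
    have := Measure.addHaar_sphere (volume : Measure ℂ) a t
    filter_upwards [measure_eq_zero_iff_ae_notMem.1 this] with c hc h
    exact hc (by rwa [mem_sphere, dist_eq_norm])
  filter_upwards [hae _ hfg, hae _ hl1, hae _ hl2, hsph] with c h1 h2 h3 h4 hcU
  have hc : c ∈ U := hcU (mem_closedBall_self ht.le)
  have hUn : U ∈ 𝓝 c := mem_of_superset (closedBall_mem_nhds c ht) hcU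
  have heq : f =ᶠ[𝓝 c] (∏ᶠ u, (· - u) ^ D u) * g := by
    rw [EventuallyEq, ← pure_sup_nhdsNE, eventually_sup]
    refine ⟨h1 hc, ?_⟩
    have h5 := hfg
    rw [EventuallyEq, Filter.Eventually, mem_codiscreteWithin] at h5
    have h6 := h5 c hc
    rw [disjoint_principal_right] at h6
    filter_upwards [h6, mem_nhdsWithin_of_mem_nhds hUn] with x hx hxU
    by_contra hne
    exact hx ⟨hxU, hne⟩
  have hld : logDeriv f c = ∑ a ∈ S, (D a : ℂ) * (c - a)⁻¹ + logDeriv g c := by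
    have h5 : logDeriv f c = logDeriv ((∏ᶠ u, (· - u) ^ D u) * g) c := by
      rw [logDeriv_apply, logDeriv_apply, heq.deriv_eq, heq.eq_of_nhds]
    rw [h5, h2 hc, Pi.add_apply, h3 hc, finsum_eq_sum_of_support_subset (s := S)]
    · congr 1
      refine Finset.sum_congr rfl fun a _ => ?_
      simp [logDeriv_apply]
    · refine Subset.trans (fun u hu => ?_) hS
      rw [Function.mem_support] at hu ⊢
      contrapose! hu
      simp [hu]
  have hsU : sphere c |t| ⊆ U := by
    rw [abs_of_pos ht]
    exact sphere_subset_closedBall.trans hcU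
  rw [logDeriv_eq_fourierCoeffOne_add_sum ht (hg.mono hcU) (fun z hz => hg0 ⟨z, hcU hz⟩) ?_ hld h4]
  · refine (enorm_add_le _ _).trans (add_le_add (enorm_fourierCoeffOne_le _ c ht) ?_)
    refine (enorm_sum_le _ _).trans (Finset.sum_le_sum fun a _ => ?_)
    rw [enorm_mul]
    gcongr
    · rw [← ofReal_norm, ← ofReal_norm]
      simp
    · split_ifs with h
      · rw [indicator_of_mem (by rwa [mem_ball, dist_eq_norm])]
        rcases eq_or_ne c a with rfl | hca
        · simp
        · rw [← enorm_inv (sub_ne_zero.2 hca), ← ofReal_norm, ← ofReal_norm]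
          refine ENNReal.ofReal_le_ofReal ?_
          rw [norm_inv]
          exact norm_inv_sub_conj_div_le h
      · simp
  · filter_upwards [codiscreteWithin_mono hsU hlog] with w hw
    rw [hw, Pi.add_apply, hsumEq]

/-! ### Counting functions and Jensen's formula -/

/-- The order of a meromorphic function at a point as an integer: positive at zeros, negative at
poles, and `0` by convention where `f` vanishes identically. -/
noncomputable def orderInt (f : ℂ → ℂ) (z : ℂ) : ℤ := (meromorphicOrderAt f z).untop₀

lemma MeromorphicOn.closedBall_of_ball {f : ℂ → ℂ} {R r : ℝ} (hf : MeromorphicOn f (ball 0 R))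
    (hr : r < R) : MeromorphicOn f (closedBall 0 r) :=
  hf.mono_set (closedBall_subset_ball hr)

lemma MeromorphicOn.sphere_of_ball {f : ℂ → ℂ} {R r : ℝ} (hf : MeromorphicOn f (ball 0 R))
    (hr0 : 0 < r) (hr : r < R) : MeromorphicOn f (sphere 0 |r|) := by
  rw [abs_of_pos hr0]
  exact hf.mono_set (sphere_subset_closedBall.trans (closedBall_subset_ball hr))

lemma divisor_closedBall_of_norm_le {f : ℂ → ℂ} {r : ℝ} (hf : MeromorphicOn f (closedBall 0 r))
    {z : ℂ} (hz : ‖z‖ ≤ r) : MeromorphicOn.divisor f (closedBall 0 r) z = orderInt f z :=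
  MeromorphicOn.divisor_apply hf (mem_closedBall_zero_iff.2 hz)

lemma divisor_closedBall_of_lt_norm {f : ℂ → ℂ} {r : ℝ} {z : ℂ} (hz : r < ‖z‖) :
    MeromorphicOn.divisor f (closedBall 0 r) z = 0 :=
  Function.locallyFinsuppWithin.apply_eq_zero_of_notMem _
    (fun h => not_lt.2 (mem_closedBall_zero_iff.1 h) hz)

lemma MeromorphicOn.exists_finset_orderInt {f : ℂ → ℂ} {r : ℝ}
    (hf : MeromorphicOn f (closedBall 0 r)) :
    ∃ S : Finset ℂ, ∀ z, z ∈ S ↔ ‖z‖ ≤ r ∧ orderInt f z ≠ 0 := by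
  have hfin := (MeromorphicOn.divisor f (closedBall 0 r)).finiteSupport (isCompact_closedBall 0 r)
  refine ⟨hfin.toFinset, fun z => ?_⟩
  rw [Finite.mem_toFinset, Function.mem_support]
  rcases le_or_gt ‖z‖ r with h | h
  · rw [divisor_closedBall_of_norm_le hf h]
    simp [h]
  · rw [divisor_closedBall_of_lt_norm h]
    simp [h]

lemma mul_posLog_div_eq_zero {d r : ℝ} {z : ℂ} (hr : 0 < r) (h : ‖z‖ ≤ r → d = 0) :
    d * log⁺ (r * ‖z‖⁻¹) = 0 := by
  rcases le_or_gt ‖z‖ r with hz | hz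
  · rw [h hz, zero_mul]
  · rw [(posLog_eq_zero_iff _).2, mul_zero]
    rw [abs_of_nonneg (by positivity), ← div_eq_mul_inv, div_le_one (hr.trans hz)]
    exact hz.le

/-- A counting sum over the closed disc of radius `r` can be taken over any larger finite set, if
`log` is replaced by `log⁺`. -/
lemma finsum_mul_log_eq_sum_posLog {d' d : ℂ → ℝ} {r : ℝ} {S : Finset ℂ} (hr : 0 < r)
    (h1 : ∀ z, ‖z‖ ≤ r → d' z = d z) (h2 : ∀ z, r < ‖z‖ → d' z = 0)
    (hS : ∀ z, ‖z‖ ≤ r → d z ≠ 0 → z ∈ S) :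
    ∑ᶠ z, d' z * log (r * ‖z‖⁻¹) = ∑ z ∈ S, d z * log⁺ (r * ‖z‖⁻¹) := by
  have h3 : ∀ z, d' z * log (r * ‖z‖⁻¹) = d z * log⁺ (r * ‖z‖⁻¹) := by
    intro z
    rcases le_or_gt ‖z‖ r with hz | hz
    · rw [h1 z hz]
      rcases eq_or_ne z 0 with rfl | h0
      · simp
      · rw [posLog_eq_log]
        rw [abs_of_nonneg (by positivity), ← div_eq_mul_inv, one_le_div (by positivity)]
        exact hz
    · rw [h2 z hz, zero_mul, mul_posLog_div_eq_zero hr (fun h => absurd hz (not_lt.2 h))]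
  rw [finsum_congr h3]
  refine finsum_eq_sum_of_support_subset _ fun z hz => ?_
  rw [Function.mem_support] at hz
  by_contra hzS
  exact hz (mul_posLog_div_eq_zero hr fun h => by_contra fun hd => hzS (hS z h hd))

lemma poleCounting_eq_sum {f : ℂ → ℂ} {r : ℝ} (hr : 0 < r)
    (hf : MeromorphicOn f (closedBall 0 r)) {S : Finset ℂ}
    (hS : ∀ z, ‖z‖ ≤ r → orderInt f z ≠ 0 → z ∈ S) :
    poleCounting f r = ∑ z ∈ S, (((orderInt f z)⁻ : ℤ) : ℝ) * log⁺ (r * ‖z‖⁻¹)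
      + (((orderInt f 0)⁻ : ℤ) : ℝ) * log r := by
  rw [poleCounting, abs_of_pos hr]
  simp only [Function.locallyFinsuppWithin.negPart_apply]
  rw [divisor_closedBall_of_norm_le hf (by simpa using hr.le)]
  congr 1
  refine finsum_mul_log_eq_sum_posLog hr (fun z hz => ?_) (fun z hz => ?_) (fun z hz h => ?_)
  · rw [divisor_closedBall_of_norm_le hf hz]
  · rw [divisor_closedBall_of_lt_norm hz]; simp
  · refine hS z hz fun h0 => h ?_
    rw [h0]; simp

lemma circleAverage_log_norm_eq_sum {f : ℂ → ℂ} {r : ℝ} (hr : 0 < r)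
    (hf : MeromorphicOn f (closedBall 0 r)) {S : Finset ℂ}
    (hS : ∀ z, ‖z‖ ≤ r → orderInt f z ≠ 0 → z ∈ S) :
    circleAverage (fun z => log ‖f z‖) 0 r = ∑ z ∈ S, (orderInt f z : ℝ) * log⁺ (r * ‖z‖⁻¹)
      + (orderInt f 0 : ℝ) * log r + log ‖meromorphicTrailingCoeffAt f 0‖ := by
  rw [MeromorphicOn.circleAverage_log_norm hr.ne' (by rwa [abs_of_pos hr]), abs_of_pos hr]
  simp only [zero_sub, norm_neg]
  rw [divisor_closedBall_of_norm_le hf (by simpa using hr.le)]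
  congr 2
  refine finsum_mul_log_eq_sum_posLog hr (fun z hz => ?_) (fun z hz => ?_) (fun z hz h => ?_)
  · rw [divisor_closedBall_of_norm_le hf hz]
  · rw [divisor_closedBall_of_lt_norm hz]; simp
  · exact hS z hz fun h0 => h (by rw [h0]; simp)

lemma negPart_add_negPart_add_self (n : ℤ) : ((n⁻ : ℤ) : ℝ) = (|(n : ℝ)| - n) / 2 := by
  rcases le_total 0 n with h | h
  · have h1 : (0 : ℝ) ≤ n := by exact_mod_cast h
    rw [negPart_eq_zero.2 h, abs_of_nonneg h1]; simp
  · have h1 : (n : ℝ) ≤ 0 := by exact_mod_cast h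
    rw [negPart_of_nonpos h, abs_of_nonpos h1]; push_cast; ring

lemma abs_log_eq (x : ℝ) : |log x| = 2 * log⁺ x - log x := by
  rw [posLog_apply]
  rcases le_total 0 (log x) with h | h
  · rw [abs_of_nonneg h, max_eq_right h]; ring
  · rw [abs_of_nonpos h, max_eq_left h]; ring

/-- Jensen's formula in the form that controls zeros, poles and the mean of `|log ‖f‖|` at the same
time by twice the characteristic. -/
lemma circleAverage_abs_log_norm_add_sum {f : ℂ → ℂ} {r : ℝ} (hr : 0 < r)
    (hf : MeromorphicOn f (closedBall 0 r)) {S : Finset ℂ}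
    (hS : ∀ z, ‖z‖ ≤ r → orderInt f z ≠ 0 → z ∈ S) :
    circleAverage (fun z => |log ‖f z‖|) 0 r
        + ∑ z ∈ S, |(orderInt f z : ℝ)| * log⁺ (r * ‖z‖⁻¹)
      = 2 * nevanlinnaT f r - |(orderInt f 0 : ℝ)| * log r
        - log ‖meromorphicTrailingCoeffAt f 0‖ := by
  have hsph : MeromorphicOn f (sphere 0 |r|) := by
    rw [abs_of_pos hr]; exact hf.mono_set sphere_subset_closedBall
  have h1 : circleAverage (fun z => |log ‖f z‖|) 0 r
      = 2 * circleAverage (fun z => log⁺ ‖f z‖) 0 r - circleAverage (fun z => log ‖f z‖) 0 r := by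
    simp only [abs_log_eq]
    rw [circleAverage_fun_sub (f₁ := fun z => 2 * log⁺ ‖f z‖)
      (IntervalIntegrable.const_mul hsph.circleIntegrable_posLog_norm 2)
      hsph.circleIntegrable_log_norm]
    congr 1
    exact circleAverage_fun_smul (a := (2 : ℝ)) (f := fun z => log⁺ ‖f z‖)
  rw [h1, circleAverage_log_norm_eq_sum hr hf hS, nevanlinnaT, poleCounting_eq_sum hr hf hS,
    ValueDistribution.proximity_top]
  simp only [negPart_add_negPart_add_self]
  have h2 : ∑ z ∈ S, (|(orderInt f z : ℝ)| - orderInt f z) / 2 * log⁺ (r * ‖z‖⁻¹)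
      = (∑ z ∈ S, |(orderInt f z : ℝ)| * log⁺ (r * ‖z‖⁻¹)
        - ∑ z ∈ S, (orderInt f z : ℝ) * log⁺ (r * ‖z‖⁻¹)) / 2 := by
    rw [← Finset.sum_sub_distrib, Finset.sum_div]
    exact Finset.sum_congr rfl fun z _ => by ring
  rw [h2]
  ring

lemma div_le_posLog_of_norm_le {ρ r R : ℝ} {z : ℂ} (hz0 : z ≠ 0) (hz : ‖z‖ ≤ ρ) (hρr : ρ ≤ r)
    (hrR : r ≤ R) : (r - ρ) / R ≤ log⁺ (r * ‖z‖⁻¹) := by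
  have h0 : 0 < ‖z‖ := norm_pos_iff.2 hz0
  have hρ : 0 < ρ := h0.trans_le hz
  have hr : 0 < r := hρ.trans_le hρr
  calc (r - ρ) / R ≤ (r - ρ) / r := by
        apply div_le_div_of_nonneg_left (by linarith) hr hrR
    _ = 1 - (r / ρ)⁻¹ := by field_simp
    _ ≤ log (r / ρ) := one_sub_inv_le_log_of_pos (by positivity)
    _ ≤ log (r * ‖z‖⁻¹) := by
        rw [← div_eq_mul_inv]
        exact log_le_log (by positivity) (by gcongr)
    _ ≤ log⁺ (r * ‖z‖⁻¹) := by rw [posLog_apply]; exact le_max_right _ _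

/-- Bounds in terms of the characteristic for the mean of `|log ‖f‖|` and for the number of
zeros and poles in a smaller disc. -/
lemma exists_circleAverage_abs_log_norm_le {f : ℂ → ℂ} {R r₁ : ℝ}
    (hf : MeromorphicOn f (ball 0 R)) (hr₁ : 0 < r₁) :
    ∃ C > 0, ∀ r, r₁ ≤ r → r < R → 0 ≤ 2 * nevanlinnaT f r + C ∧
      circleAverage (fun z => |log ‖f z‖|) 0 r ≤ 2 * nevanlinnaT f r + C ∧
      ∀ ρ ≤ r, ∀ S : Finset ℂ, (∀ z ∈ S, ‖z‖ ≤ ρ) →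
        (∑ z ∈ S, |(orderInt f z : ℝ)|) * ((r - ρ) / R) ≤ 2 * nevanlinnaT f r + C := by
  set d := |(orderInt f 0 : ℝ)| with hd
  set C₀ := d * |log r₁| + |log ‖meromorphicTrailingCoeffAt f 0‖| with hC₀
  have hd0 : 0 ≤ d := abs_nonneg _
  have hC₀0 : 0 ≤ C₀ := by positivity
  refine ⟨C₀ + d + 1, by positivity, fun r hr hrR => ?_⟩
  have hr0 : 0 < r := hr₁.trans_le hr
  have hfr := hf.closedBall_of_ball hrR
  have hC : - d * log r - log ‖meromorphicTrailingCoeffAt f 0‖ ≤ C₀ := by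
    have h1 : log r₁ ≤ log r := log_le_log hr₁ hr
    have h2 : -|log r₁| ≤ log r₁ := neg_abs_le _
    have h3 := neg_abs_le (log ‖meromorphicTrailingCoeffAt f 0‖)
    have h4 : d * (-|log r₁|) ≤ d * log r := mul_le_mul_of_nonneg_left (h2.trans h1) hd0
    rw [hC₀]
    linarith
  have havg : 0 ≤ circleAverage (fun z => |log ‖f z‖|) 0 r :=
    circleAverage_nonneg_of_nonneg fun z _ => abs_nonneg _
  obtain ⟨S₀, hS₀⟩ := hfr.exists_finset_orderInt
  classical
  have key : ∀ S : Finset ℂ, circleAverage (fun z => |log ‖f z‖|) 0 r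
        + ∑ z ∈ S, |(orderInt f z : ℝ)| * log⁺ (r * ‖z‖⁻¹) ≤ 2 * nevanlinnaT f r + C₀ := by
    intro S
    have h1 := circleAverage_abs_log_norm_add_sum hr0 hfr (S := S ∪ S₀)
      (fun z hz h => Finset.mem_union_right _ ((hS₀ z).2 ⟨hz, h⟩))
    have h2 : ∑ z ∈ S, |(orderInt f z : ℝ)| * log⁺ (r * ‖z‖⁻¹)
        ≤ ∑ z ∈ S ∪ S₀, |(orderInt f z : ℝ)| * log⁺ (r * ‖z‖⁻¹) :=
      Finset.sum_le_sum_of_subset_of_nonneg Finset.subset_union_left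
        fun z _ _ => mul_nonneg (abs_nonneg _) posLog_nonneg
    linarith
  have hk0 := key ∅
  rw [Finset.sum_empty] at hk0
  refine ⟨by linarith, by linarith, fun ρ hρ S hS => ?_⟩
  have hR : 0 < R := hr0.trans hrR
  have h1 : ∀ z ∈ S, |(orderInt f z : ℝ)| * ((r - ρ) / R)
      ≤ |(orderInt f z : ℝ)| * log⁺ (r * ‖z‖⁻¹) + if z = 0 then d else 0 := by
    intro z hz
    split_ifs with h0
    · subst h0
      have hρ0 : 0 ≤ ρ := by simpa using hS 0 hz
      have : (r - ρ) / R ≤ 1 := by rw [div_le_one hR]; linarith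
      have h2 : 0 ≤ |(orderInt f 0 : ℝ)| * log⁺ (r * ‖(0 : ℂ)‖⁻¹) :=
        mul_nonneg (abs_nonneg _) posLog_nonneg
      have h3 : d * ((r - ρ) / R) ≤ d * 1 := mul_le_mul_of_nonneg_left this hd0
      linarith
    · rw [add_zero]
      exact mul_le_mul_of_nonneg_left (div_le_posLog_of_norm_le h0 (hS z hz) hρ hrR.le)
        (abs_nonneg _)
  have h2 := Finset.sum_le_sum h1
  rw [Finset.sum_add_distrib, ← Finset.sum_mul] at h2
  have h3 : ∑ z ∈ S, (if z = 0 then d else 0) ≤ d := by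
    rw [Finset.sum_ite_eq' S (0 : ℂ) fun _ => d]
    split_ifs <;> linarith
  linarith [key S]

lemma negPart_orderInt_deriv_le {f : ℂ → ℂ} {z : ℂ} (hf : MeromorphicAt f z) :
    (orderInt (deriv f) z)⁻ ≤ 2 * (orderInt f z)⁻ := by
  unfold orderInt
  by_cases htop : meromorphicOrderAt f z = ⊤
  · have h1 : f =ᶠ[𝓝[≠] z] fun _ => 0 := meromorphicOrderAt_eq_top_iff.1 htop
    have h2 : meromorphicOrderAt (deriv f) z = ⊤ := by
      rw [meromorphicOrderAt_eq_top_iff]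
      filter_upwards [h1.nhdsNE_deriv] with w hw
      rw [hw, deriv_const]
    simp [h2, htop]
  obtain ⟨n, hn⟩ := WithTop.ne_top_iff_exists.1 htop
  rcases lt_or_ge n 0 with h | h
  · rw [meromorphicOrderAt_deriv_eq_sub_one (by exact_mod_cast h.ne) hn.symm, ← hn]
    simp only [WithTop.untop₀_coe]
    rw [negPart_of_nonpos (by omega), negPart_of_nonpos h.le]
    omega
  · obtain ⟨g, hg, -, hfg⟩ := (meromorphicOrderAt_eq_int_iff hf).1 hn.symm
    have h1 : f =ᶠ[𝓝[≠] z] fun w => (w - z) ^ n * g w := hfg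
    have h2 : AnalyticAt ℂ (fun w => (w - z) ^ n * g w) z :=
      (AnalyticAt.fun_zpow_nonneg (by fun_prop) h).mul hg
    have h3 : 0 ≤ meromorphicOrderAt (deriv f) z := by
      rw [meromorphicOrderAt_congr h1.nhdsNE_deriv]
      exact h2.deriv.meromorphicOrderAt_nonneg
    have h4 : 0 ≤ (meromorphicOrderAt (deriv f) z).untop₀ := by
      simpa using h3
    rw [negPart_eq_zero.2 h4]
    positivity

/-- Differentiation at most doubles the multiplicity of each pole. -/
lemma exists_poleCounting_deriv_le {f : ℂ → ℂ} {R r₁ : ℝ}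
    (hf : MeromorphicOn f (ball 0 R)) (hr₁ : 0 < r₁) :
    ∃ C > 0, ∀ r, r₁ ≤ r → r < R → poleCounting (deriv f) r ≤ 2 * poleCounting f r + C := by
  set a : ℝ := (((orderInt f 0)⁻ : ℤ) : ℝ)
  set b : ℝ := (((orderInt (deriv f) 0)⁻ : ℤ) : ℝ)
  refine ⟨(|b| + 2 * |a|) * (|log r₁| + |log R|) + 1, by positivity, fun r hr hrR => ?_⟩
  have hr0 : 0 < r := hr₁.trans_le hr
  have hfr := hf.closedBall_of_ball hrR
  obtain ⟨S, hS⟩ := hfr.exists_finset_orderInt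
  obtain ⟨S', hS'⟩ := hfr.deriv.exists_finset_orderInt
  classical
  rw [poleCounting_eq_sum hr0 hfr.deriv (S := S ∪ S')
      (fun z hz h => Finset.mem_union_right _ ((hS' z).2 ⟨hz, h⟩)),
    poleCounting_eq_sum hr0 hfr (S := S ∪ S')
      (fun z hz h => Finset.mem_union_left _ ((hS z).2 ⟨hz, h⟩))]
  have h1 : ∑ z ∈ S ∪ S', (((orderInt (deriv f) z)⁻ : ℤ) : ℝ) * log⁺ (r * ‖z‖⁻¹)
      ≤ 2 * ∑ z ∈ S ∪ S', (((orderInt f z)⁻ : ℤ) : ℝ) * log⁺ (r * ‖z‖⁻¹) := by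
    rw [Finset.mul_sum]
    refine Finset.sum_le_sum fun z hz => ?_
    rw [← mul_assoc]
    refine mul_le_mul_of_nonneg_right ?_ posLog_nonneg
    have hz' : z ∈ closedBall (0 : ℂ) r := by
      rw [mem_closedBall_zero_iff]
      rcases Finset.mem_union.1 hz with h | h
      · exact ((hS z).1 h).1
      · exact ((hS' z).1 h).1
    exact_mod_cast negPart_orderInt_deriv_le (hfr z hz')
  have hlog : |log r| ≤ |log r₁| + |log R| := by
    have h2 : log r₁ ≤ log r := log_le_log hr₁ hr
    have h3 : log r ≤ log R := log_le_log hr0 hrR.le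
    rw [abs_le]
    constructor
    · linarith [neg_abs_le (log r₁), abs_nonneg (log R)]
    · linarith [le_abs_self (log R), abs_nonneg (log r₁)]
  have h4 : b * log r ≤ |b| * (|log r₁| + |log R|) :=
    (le_abs_self _).trans (by rw [abs_mul]; gcongr)
  have h5 : -(2 * (a * log r)) ≤ 2 * |a| * (|log r₁| + |log R|) := by
    have : -(a * log r) ≤ |a| * (|log r₁| + |log R|) :=
      (neg_le_abs _).trans (by rw [abs_mul]; gcongr)
    linarith
  change _ + b * log r ≤ 2 * (_ + a * log r) + _
  linarith

/-! ### Monotonicity of the characteristic -/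

section Cartan
open ValueDistribution.Cartan

/-- The mean of `|log ‖f - a‖|` over `a` in the unit circle. -/
lemma integral_norm_cartanKernel (f : ℂ → ℂ) (r β : ℝ) :
    ∫ α in Ioc 0 (2 * π), ‖cartanKernel f r α β‖ =
      2 * (∫ α in Ioc 0 (2 * π), (cartanKernel f r α β)⁺) -
        (2 * π) * log⁺ ‖f (circleMap 0 r β)‖ := by
  have h1 : circleAverage (log ‖f (circleMap 0 r β) - ·‖) 0 1
      = log⁺ ‖f (circleMap 0 r β)‖ := by simp [norm_sub_rev]
  have h2 : ∫ α in Ioc 0 (2 * π), cartanKernel f r α β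
      = (2 * π) * log⁺ ‖f (circleMap 0 r β)‖ := by
    rw [← h1, circleAverage_def, intervalIntegral.integral_of_le two_pi_pos.le, smul_eq_mul,
      mul_inv_cancel_left₀ two_pi_pos.ne']
    rfl
  rw [← h2]
  exact integral_abs_eq_two_mul_integral_posPart_sub_integral
    (integrableOn_cartanKernel_left f r β)

lemma integrable_integral_norm_cartanKernel' {f : ℂ → ℂ} {r : ℝ} (hm : Measurable f)
    (hf : MeromorphicOn f (sphere 0 |r|)) :
    Integrable (fun β => ∫ α in Ioc 0 (2 * π), ‖cartanKernel f r α β‖)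
      (volume.restrict (Ioc 0 (2 * π))) := by
  have hmK : Measurable (fun a : ℝ × ℝ => (cartanKernel f r a.1 a.2)⁺) :=
    (measurable_cartanKernel hm).sup_const 0
  have hpos : Integrable (fun β => log⁺ ‖f (circleMap 0 r β)‖)
      (volume.restrict (Ioc 0 (2 * π))) := by
    have := hf.circleIntegrable_posLog_norm
    rwa [CircleIntegrable, intervalIntegrable_iff_integrableOn_Ioc_of_le two_pi_pos.le] at this
  have hT : Integrable (fun β => ∫ α in Ioc 0 (2 * π), (cartanKernel f r α β)⁺)
      (volume.restrict (Ioc 0 (2 * π))) := by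
    refine Integrable.mono ((hpos.add (integrable_const (log 2))).const_mul (2 * π))
      hmK.stronglyMeasurable.integral_prod_left'.aestronglyMeasurable ?_
    filter_upwards with β
    rw [norm_of_nonneg (integral_nonneg fun α => posPart_nonneg _), Pi.add_apply,
      norm_of_nonneg (mul_nonneg two_pi_pos.le
        (add_nonneg posLog_nonneg (log_nonneg one_le_two)))]
    have h3 : ∫ α in Ioc 0 (2 * π), (cartanKernel f r α β)⁺
        ≤ ∫ _ in Ioc 0 (2 * π), (log⁺ ‖f (circleMap 0 r β)‖ + log 2) := by
      refine integral_mono_of_nonneg (.of_forall fun α => posPart_nonneg _) (integrable_const _)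
        (.of_forall fun α => ?_)
      have h4 : (cartanKernel f r α β)⁺ = log⁺ ‖f (circleMap 0 r β) + (-circleMap 0 1 α)‖ := by
        simp [cartanKernel, posLog_def, posPart, max_comm, sub_eq_add_neg]
      have h5 := posLog_norm_add_le (f (circleMap 0 r β)) (-circleMap 0 1 α)
      simp only [h4]
      simpa [norm_circleMap_zero, add_comm] using h5
    rwa [integral_const, smul_eq_mul, measureReal_restrict_apply_univ,
      volume_real_Ioc_of_le two_pi_pos.le, sub_zero] at h3
  exact ((hT.const_mul 2).sub (hpos.const_mul (2 * π))).congr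
    (.of_forall fun β => (integral_norm_cartanKernel f r β).symm)

lemma integrable_cartanKernel {f : ℂ → ℂ} {r : ℝ} (hm : Measurable f)
    (hf : MeromorphicOn f (sphere 0 |r|)) :
    Integrable (fun p : ℝ × ℝ => cartanKernel f r p.1 p.2)
      ((volume.restrict (Ioc 0 (2 * π))).prod (volume.restrict (Ioc 0 (2 * π)))) :=
  (integrable_prod_iff' (measurable_cartanKernel hm).aestronglyMeasurable).2
    ⟨Eventually.of_forall (integrableOn_cartanKernel_left f r),
      integrable_integral_norm_cartanKernel' hm hf⟩

lemma circleIntegrable_circleAverage_log_norm_sub_of_sphere {f : ℂ → ℂ} {r : ℝ}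
    (hm : Measurable f) (hf : MeromorphicOn f (sphere 0 |r|)) :
    CircleIntegrable (fun a => circleAverage (fun z => log ‖f z - a‖) 0 r) 0 1 := by
  rw [CircleIntegrable, intervalIntegrable_iff_integrableOn_Ioc_of_le two_pi_pos.le]
  refine (((integrable_cartanKernel hm hf).integral_prod_left).const_mul (2 * π)⁻¹).congr
    (.of_forall fun α => ?_)
  simp [circleAverage, cartanKernel, intervalIntegral.integral_of_le two_pi_pos.le]

/-- The proximity function as an iterated mean; only the values of `f` on one circle enter. -/
lemma circleAverage_circleAverage_log_norm_sub {f : ℂ → ℂ} {r : ℝ}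
    (hm : Measurable f) (hf : MeromorphicOn f (sphere 0 |r|)) :
    circleAverage (fun a => circleAverage (fun z => log ‖f z - a‖) 0 r) 0 1
      = ValueDistribution.proximity f ⊤ r := by
  have h1 : circleAverage (fun a => circleAverage (fun z => log ‖f z - a‖) 0 r) 0 1
      = (2 * π)⁻¹ * ((2 * π)⁻¹ * ∫ α in Ioc 0 (2 * π), ∫ β in Ioc 0 (2 * π),
        cartanKernel f r α β) := by
    simp only [circleAverage, cartanKernel, smul_eq_mul,
      intervalIntegral.integral_of_le two_pi_pos.le, integral_const_mul]
  rw [h1, integral_integral_swap (integrable_cartanKernel hm hf), ← integral_const_mul,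
    ValueDistribution.proximity_top, circleAverage_def, smul_eq_mul,
    intervalIntegral.integral_of_le two_pi_pos.le]
  congr 2
  ext β
  have h2 : circleAverage (log ‖f (circleMap 0 r β) - ·‖) 0 1
      = log⁺ ‖f (circleMap 0 r β)‖ := by simp [norm_sub_rev]
  rw [← h2, circleAverage_def, smul_eq_mul, intervalIntegral.integral_of_le two_pi_pos.le]
  rfl

end Cartan

/-- The poles of `f - a` are those of `f`, so `f - a` vanishes to order at least `-n` at a pole of
multiplicity `n`. -/
lemma orderInt_sub_const_add_negPart_orderInt_nonneg {f : ℂ → ℂ} {z : ℂ} (hf : MeromorphicAt f z)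
    (a : ℂ) : 0 ≤ orderInt (fun w => f w - a) z + (orderInt f z)⁻ := by
  unfold orderInt
  have h1 : min (meromorphicOrderAt f z) (meromorphicOrderAt (fun _ : ℂ => -a) z)
      ≤ meromorphicOrderAt (fun w => f w - a) z := by
    have := meromorphicOrderAt_add hf (MeromorphicAt.const (-a) z)
    simpa [sub_eq_add_neg, Pi.add_def] using this
  have h2 : 0 ≤ meromorphicOrderAt (fun _ : ℂ => -a) z :=
    (analyticAt_const (v := -a)).meromorphicOrderAt_nonneg
  have h3 : min (meromorphicOrderAt f z) 0 ≤ meromorphicOrderAt (fun w => f w - a) z :=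
    (min_le_min_left _ h2).trans h1
  by_cases htop : meromorphicOrderAt (fun w => f w - a) z = ⊤
  · simp [htop, negPart_nonneg]
  obtain ⟨m, hm⟩ := WithTop.ne_top_iff_exists.1 htop
  rw [← hm] at h3 ⊢
  rw [WithTop.untop₀_coe]
  by_cases htop' : meromorphicOrderAt f z = ⊤
  · rw [htop', min_eq_right le_top] at h3
    have : 0 ≤ m := by exact_mod_cast h3
    simp [htop', this]
  obtain ⟨n, hn⟩ := WithTop.ne_top_iff_exists.1 htop'
  rw [← hn] at h3 ⊢
  rw [WithTop.untop₀_coe]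
  have h4 : min n 0 ≤ m := by exact_mod_cast h3
  rcases le_total 0 n with h | h
  · rw [negPart_eq_zero.2 h]; omega
  · rw [negPart_of_nonpos h]; omega

/-- By Jensen's formula, up to a constant, the quantity compared here is the counting function of
the zeros of `f - a`, which increases with the radius. -/
lemma circleAverage_log_norm_sub_add_poleCounting_mono {f : ℂ → ℂ} {R : ℝ}
    (hf : MeromorphicOn f (ball 0 R)) (a : ℂ) {r r' : ℝ} (hr : 0 < r) (hrr : r ≤ r')
    (hr' : r' < R) :
    circleAverage (fun z => log ‖f z - a‖) 0 r + poleCounting f r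
      ≤ circleAverage (fun z => log ‖f z - a‖) 0 r' + poleCounting f r' := by
  have hfr := hf.closedBall_of_ball hr'
  have har : MeromorphicOn (fun w => f w - a) (closedBall 0 r') :=
    fun z hz => (hfr z hz).sub (MeromorphicAt.const a z)
  obtain ⟨S, hS⟩ := hfr.exists_finset_orderInt
  obtain ⟨S', hS'⟩ := har.exists_finset_orderInt
  classical
  have hr0' := hr.trans_le hrr
  have hcb : closedBall (0 : ℂ) r ⊆ closedBall 0 r' := closedBall_subset_closedBall hrr
  rw [circleAverage_log_norm_eq_sum (f := fun w => f w - a) hr (har.mono_set hcb) (S := S ∪ S')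
      (fun z hz h => Finset.mem_union_right _ ((hS' z).2 ⟨hz.trans hrr, h⟩)),
    circleAverage_log_norm_eq_sum (f := fun w => f w - a) hr0' har (S := S ∪ S')
      (fun z hz h => Finset.mem_union_right _ ((hS' z).2 ⟨hz, h⟩)),
    poleCounting_eq_sum hr (hfr.mono_set hcb) (S := S ∪ S')
      (fun z hz h => Finset.mem_union_left _ ((hS z).2 ⟨hz.trans hrr, h⟩)),
    poleCounting_eq_sum hr0' hfr (S := S ∪ S')
      (fun z hz h => Finset.mem_union_left _ ((hS z).2 ⟨hz, h⟩))]
  have h0 : ∀ z ∈ closedBall (0 : ℂ) r',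
      (0 : ℝ) ≤ (orderInt (fun w => f w - a) z : ℝ) + (((orderInt f z)⁻ : ℤ) : ℝ) :=
    fun z hz => by exact_mod_cast orderInt_sub_const_add_negPart_orderInt_nonneg (hfr z hz) a
  have h1 : ∑ z ∈ S ∪ S', ((orderInt (fun w => f w - a) z : ℝ) + (((orderInt f z)⁻ : ℤ) : ℝ))
        * log⁺ (r * ‖z‖⁻¹)
      ≤ ∑ z ∈ S ∪ S', ((orderInt (fun w => f w - a) z : ℝ) + (((orderInt f z)⁻ : ℤ) : ℝ))
        * log⁺ (r' * ‖z‖⁻¹) := by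
    refine Finset.sum_le_sum fun z hz => mul_le_mul_of_nonneg_left ?_ (h0 z ?_)
    · exact posLog_le_posLog (by positivity) (by gcongr)
    · rw [mem_closedBall_zero_iff]
      rcases Finset.mem_union.1 hz with h | h
      · exact ((hS z).1 h).1
      · exact ((hS' z).1 h).1
  have h2 : ((orderInt (fun w => f w - a) 0 : ℝ) + (((orderInt f 0)⁻ : ℤ) : ℝ)) * log r
      ≤ ((orderInt (fun w => f w - a) 0 : ℝ) + (((orderInt f 0)⁻ : ℤ) : ℝ)) * log r' :=
    mul_le_mul_of_nonneg_left (log_le_log hr hrr) (h0 0 (by simpa using hr0'.le))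
  simp only [add_mul, Finset.sum_add_distrib] at h1 h2
  linarith

/-- The Nevanlinna characteristic is increasing: by Cartan's identity it is a mean over `a` in the
unit circle of counting functions of `a`-points. -/
lemma nevanlinnaT_mono {f : ℂ → ℂ} {R : ℝ} (hm : Measurable f)
    (hf : MeromorphicOn f (ball 0 R)) {r r' : ℝ} (hr : 0 < r) (hrr : r ≤ r') (hr' : r' < R) :
    nevanlinnaT f r ≤ nevanlinnaT f r' := by
  have key : ∀ ρ, 0 < ρ → ρ < R →
      CircleIntegrable (fun a => circleAverage (fun z => log ‖f z - a‖) 0 ρ + poleCounting f ρ) 0 1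
      ∧ nevanlinnaT f ρ = circleAverage
        (fun a => circleAverage (fun z => log ‖f z - a‖) 0 ρ + poleCounting f ρ) 0 1 := by
    intro ρ h0 hR
    have hsph := hf.sphere_of_ball h0 hR
    have hi := circleIntegrable_circleAverage_log_norm_sub_of_sphere hm hsph
    have hc := circleIntegrable_const (poleCounting f ρ) 0 1
    refine ⟨hi.add hc, ?_⟩
    rw [circleAverage_fun_add hi hc, circleAverage_const,
      circleAverage_circleAverage_log_norm_sub hm hsph, nevanlinnaT]
  obtain ⟨i1, e1⟩ := key r hr (hrr.trans_lt hr')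
  obtain ⟨i2, e2⟩ := key r' (hr.trans_le hrr) hr'
  rw [e1, e2]
  exact circleAverage_mono i1 i2 fun a _ =>
    circleAverage_log_norm_sub_add_poleCounting_mono hf a hr hrr hr'

/-! ### The area integral of the logarithmic derivative -/

lemma setLIntegral_circleMap_periodic (F : ℂ → ENNReal) (τ : ℝ) :
    ∫⁻ θ in Ioo (-π) π, F (circleMap 0 τ θ) = ∫⁻ θ in Ioc 0 (2 * π), F (circleMap 0 τ θ) := by
  rw [setLIntegral_congr Ioo_ae_eq_Ioc]
  have h1 := isAddFundamentalDomain_Ioc two_pi_pos (-π)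
  have h2 := isAddFundamentalDomain_Ioc two_pi_pos 0
  rw [show -π + 2 * π = π by ring] at h1
  rw [zero_add] at h2
  refine h1.setLIntegral_eq h2 _ fun g θ => ?_
  obtain ⟨n, hn⟩ := AddSubgroup.mem_zmultiples_iff.1 g.2
  rw [AddSubgroup.vadd_def, vadd_eq_add, ← hn, add_comm]
  exact congrArg F ((periodic_circleMap 0 τ).zsmul n θ)

lemma lintegral_eq_lintegral_circleMap {F : ℂ → ENNReal} (hF : Measurable F) :
    ∫⁻ z, F z = ∫⁻ τ in Ioi (0 : ℝ), ENNReal.ofReal τ *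
      ∫⁻ θ in Ioc 0 (2 * π), F (circleMap 0 τ θ) := by
  have hcm : Measurable fun p : ℝ × ℝ => circleMap 0 p.1 p.2 := by
    unfold circleMap; fun_prop
  rw [← Complex.lintegral_comp_polarCoord_symm, polarCoord_target, Measure.volume_eq_prod,
    ← Measure.prod_restrict]
  have h1 : ∀ p : ℝ × ℝ, Complex.polarCoord.symm p = circleMap 0 p.1 p.2 := by
    intro p
    rw [Complex.polarCoord_symm_apply, circleMap, zero_add, Complex.exp_mul_I]
    push_cast
    rfl
  simp only [h1, smul_eq_mul]
  rw [lintegral_prod _ (by fun_prop)]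
  refine lintegral_congr fun τ => ?_
  dsimp only
  rw [lintegral_const_mul' _ _ ENNReal.ofReal_ne_top, setLIntegral_circleMap_periodic]

lemma setLIntegral_annulus {F : ℂ → ENNReal} (hF : Measurable F) {J : Set ℝ}
    (hJ : MeasurableSet J) (hJ0 : J ⊆ Ioi 0) :
    ∫⁻ z in {z : ℂ | ‖z‖ ∈ J}, F z = ∫⁻ τ in J, ENNReal.ofReal τ *
      ∫⁻ θ in Ioc 0 (2 * π), F (circleMap 0 τ θ) := by
  have hA : MeasurableSet {z : ℂ | ‖z‖ ∈ J} := measurable_norm hJ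
  rw [← lintegral_indicator hA, lintegral_eq_lintegral_circleMap (hF.indicator hA),
    ← inter_eq_self_of_subset_left hJ0, ← setLIntegral_indicator hJ,
    inter_eq_self_of_subset_left hJ0]
  refine setLIntegral_congr_fun measurableSet_Ioi fun τ hτ => ?_
  have hn : ∀ θ, ‖circleMap 0 τ θ‖ = τ := fun θ => by
    rw [norm_circleMap_zero, abs_of_pos hτ]
  by_cases h : τ ∈ J
  · rw [indicator_of_mem h]
    congr 1
    refine lintegral_congr fun θ => ?_
    rw [indicator_of_mem]
    simpa only [mem_ofPred_eq, hn] using h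
  · rw [indicator_of_notMem h]
    have : ∀ θ, {z : ℂ | ‖z‖ ∈ J}.indicator F (circleMap 0 τ θ) = 0 := fun θ => by
      rw [indicator_of_notMem]
      simpa only [mem_ofPred_eq, hn] using h
    simp [this]

/-- The Newtonian kernel is integrable in the plane: its integral over a disc is proportional to
the radius. -/
lemma lintegral_indicator_ball_inv (a : ℂ) (t : ℝ) :
    ∫⁻ c, (ball a t).indicator (fun z => ‖z - a‖ₑ⁻¹) c = ENNReal.ofReal (2 * π * t) := by
  have h0 : ∀ c, (ball a t).indicator (fun z => ‖z - a‖ₑ⁻¹) c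
      = (fun z : ℂ => (ball (0 : ℂ) t).indicator (fun z => ‖z‖ₑ⁻¹) z) (c - a) := by
    intro c
    by_cases h : c ∈ ball a t
    · rw [indicator_of_mem h]
      simp only
      rw [indicator_of_mem]
      rwa [mem_ball_zero_iff, ← dist_eq_norm]
    · rw [indicator_of_notMem h]
      simp only
      rw [indicator_of_notMem]
      rwa [mem_ball_zero_iff, ← dist_eq_norm]
  have hm : Measurable ((ball (0 : ℂ) t).indicator (fun z : ℂ => ‖z‖ₑ⁻¹)) :=
    (measurable_enorm.inv).indicator measurableSet_ball
  simp only [h0]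
  rw [lintegral_sub_right_eq_self (fun z : ℂ => (ball (0 : ℂ) t).indicator (fun z => ‖z‖ₑ⁻¹) z) a,
    lintegral_eq_lintegral_circleMap hm]
  have h1 : ∀ τ ∈ Ioi (0 : ℝ), ENNReal.ofReal τ * ∫⁻ θ in Ioc 0 (2 * π),
      (ball (0 : ℂ) t).indicator (fun z : ℂ => ‖z‖ₑ⁻¹) (circleMap 0 τ θ)
      = (Iio t).indicator (fun _ => ENNReal.ofReal (2 * π)) τ := by
    intro τ hτ
    have hτ' : (0 : ℝ) < τ := hτ
    have hn : ∀ θ, ‖circleMap 0 τ θ‖ = τ := fun θ => by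
      rw [norm_circleMap_zero, abs_of_pos hτ']
    by_cases h : τ < t
    · have : ∀ θ, (ball (0 : ℂ) t).indicator (fun z : ℂ => ‖z‖ₑ⁻¹) (circleMap 0 τ θ)
          = (ENNReal.ofReal τ)⁻¹ := fun θ => by
        rw [indicator_of_mem (by rwa [mem_ball_zero_iff, hn]), ← ofReal_norm, hn]
      simp only [this, lintegral_const, Measure.restrict_apply_univ, Real.volume_Ioc, sub_zero]
      rw [indicator_of_mem (by exact h), ← mul_assoc,
        ENNReal.mul_inv_cancel (by simpa using hτ') ENNReal.ofReal_ne_top, one_mul]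
    · have : ∀ θ, (ball (0 : ℂ) t).indicator (fun z : ℂ => ‖z‖ₑ⁻¹) (circleMap 0 τ θ) = 0 :=
        fun θ => by rw [indicator_of_notMem (by rwa [mem_ball_zero_iff, hn])]
      simp only [this, lintegral_zero, mul_zero]
      rw [indicator_of_notMem (by exact h)]
  rw [setLIntegral_congr_fun measurableSet_Ioi h1, setLIntegral_indicator measurableSet_Iio,
    lintegral_const, Measure.restrict_apply_univ, Iio_inter_Ioi, Real.volume_Ioo, sub_zero,
    ← ENNReal.ofReal_mul (by positivity)]

lemma lintegral_enorm_log_norm_circleMap {f : ℂ → ℂ} {τ : ℝ}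
    (hf : MeromorphicOn f (sphere 0 |τ|)) :
    ∫⁻ θ in Ioc 0 (2 * π), ‖log ‖f (circleMap 0 τ θ)‖‖ₑ
      = ENNReal.ofReal (2 * π * circleAverage (fun z => |log ‖f z‖|) 0 τ) := by
  have hi := hf.circleIntegrable_log_norm
  rw [CircleIntegrable, intervalIntegrable_iff_integrableOn_Ioc_of_le two_pi_pos.le] at hi
  rw [← ofReal_integral_norm_eq_lintegral_enorm hi, circleAverage_def, smul_eq_mul,
    mul_inv_cancel_left₀ two_pi_pos.ne', intervalIntegral.integral_of_le two_pi_pos.le]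
  rfl

/-- Averaging over translates: a mean over small circles about the points of an annulus is bounded
by the integral over a slightly wider annulus. -/
lemma setLIntegral_lintegral_circleMap_le {u : ℂ → ENNReal} (hu : Measurable u) {a b t : ℝ}
    (ht : 0 ≤ t) :
    ∫⁻ c in {z : ℂ | ‖z‖ ∈ Icc a b}, ∫⁻ θ in Ioc 0 (2 * π), u (circleMap c t θ)
      ≤ ENNReal.ofReal (2 * π) * ∫⁻ z in {z : ℂ | ‖z‖ ∈ Icc (a - t) (b + t)}, u z := by
  have hcm : Measurable fun p : ℂ × ℝ => circleMap p.1 t p.2 := by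
    unfold circleMap; fun_prop
  rw [lintegral_lintegral_swap (by exact (hu.comp hcm).aemeasurable)]
  have h1 : ∀ θ, ∫⁻ c in {z : ℂ | ‖z‖ ∈ Icc a b}, u (circleMap c t θ)
      ≤ ∫⁻ z in {z : ℂ | ‖z‖ ∈ Icc (a - t) (b + t)}, u z := by
    intro θ
    have hA : ∀ a b : ℝ, MeasurableSet {z : ℂ | ‖z‖ ∈ Icc a b} :=
      fun a b => measurable_norm measurableSet_Icc
    rw [← lintegral_indicator (hA _ _), ← lintegral_indicator (hA _ _),
      ← lintegral_add_right_eq_self ({z : ℂ | ‖z‖ ∈ Icc (a - t) (b + t)}.indicator u)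
        (circleMap 0 t θ)]
    refine lintegral_mono fun c => ?_
    have hc : circleMap c t θ = c + circleMap 0 t θ := by simp [circleMap]
    by_cases h : c ∈ {z : ℂ | ‖z‖ ∈ Icc a b}
    · rw [indicator_of_mem h, indicator_of_mem, hc]
      have hn : ‖circleMap 0 t θ‖ = t := by rw [norm_circleMap_zero, abs_of_nonneg ht]
      have h2 := norm_add_le c (circleMap 0 t θ)
      have h3 := norm_sub_le (c + circleMap 0 t θ) (circleMap 0 t θ)
      rw [add_sub_cancel_right] at h3
      exact ⟨by linarith [h.1], by linarith [h.2]⟩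
    · rw [indicator_of_notMem h]; exact zero_le
  refine (lintegral_mono h1).trans ?_
  rw [lintegral_const, Measure.restrict_apply_univ, Real.volume_Ioc, sub_zero, mul_comm]

/-- Over an annulus of width `h / 4`, the area integral of the logarithmic derivative is at most of
the order of the characteristic at distance `h`. -/
lemma exists_setLIntegral_logDeriv_le {f : ℂ → ℂ} {R r₁ : ℝ} (hm : Measurable f)
    (hf : MeromorphicOn f (ball 0 R)) (hord : ∀ z ∈ ball (0 : ℂ) R, meromorphicOrderAt f z ≠ ⊤)
    (hr₁ : 0 < r₁) (hr₁R : r₁ < R) :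
    ∃ C > 0, ∀ r h, r₁ ≤ r → 0 < h → r + h < R → 0 ≤ nevanlinnaT f (r + h) + C ∧
      ∫⁻ z in {z : ℂ | ‖z‖ ∈ Icc r (r + h / 4)}, ‖logDeriv f z‖ₑ
        ≤ ENNReal.ofReal (C * (nevanlinnaT f (r + h) + C)) := by
  obtain ⟨C₀, hC₀, hbd⟩ := exists_circleAverage_abs_log_norm_le hf (half_pos hr₁)
  have hR : 0 < R := hr₁.trans hr₁R
  -- the radius of the small circles is a fixed fraction of `h`, so that they stay away from `0`
  set κ := r₁ / (4 * R) with hκ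
  have hκ0 : 0 < κ := by positivity
  have hκ1 : κ ≤ 1 / 4 := by
    rw [hκ, div_le_div_iff₀ (by positivity) (by norm_num)]; linarith
  set K := 8 * π * R * (1 / 4 + 2 * κ) / κ + 8 * π * κ * R with hK
  have hK0 : 0 < K := by positivity
  refine ⟨K + C₀, by positivity, fun r h hr hh hrh => ?_⟩
  set t := κ * h with ht
  have ht0 : 0 < t := by positivity
  have hth : t ≤ h / 4 := by rw [ht]; nlinarith
  have htr : t ≤ r₁ / 4 := by
    have h1 : h ≤ R := by linarith
    calc t ≤ κ * R := mul_le_mul_of_nonneg_left h1 hκ0.le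
      _ = r₁ / 4 := by rw [hκ]; field_simp
  set M := 2 * nevanlinnaT f (r + h) + C₀ with hM
  have hMr := hbd (r + h) (by linarith) hrh
  have hM0 : 0 ≤ M := hMr.1
  have hMC : M ≤ 2 * (nevanlinnaT f (r + h) + (K + C₀)) := by rw [hM]; linarith
  refine ⟨by linarith, ?_⟩
  set ρ := r + h / 2 with hρ
  have hρR : ρ < R := by linarith
  have hfρ := hf.closedBall_of_ball hρR
  obtain ⟨S, hS⟩ := hfρ.exists_finset_orderInt
  have hSsupp : (MeromorphicOn.divisor f (closedBall 0 ρ)).support ⊆ S := by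
    intro z hz
    rw [Function.mem_support] at hz
    have hzρ : ‖z‖ ≤ ρ := by
      by_contra hlt
      exact hz (divisor_closedBall_of_lt_norm (not_le.1 hlt))
    rw [divisor_closedBall_of_norm_le hfρ hzρ] at hz
    exact (hS z).2 ⟨hzρ, hz⟩
  have hae := ae_enorm_logDeriv_le hfρ
    (fun u hu => hord u (closedBall_subset_ball hρR hu)) ht0 hSsupp
  set A := {z : ℂ | ‖z‖ ∈ Icc r (r + h / 4)} with hA
  have hAm : MeasurableSet A := measurable_norm measurableSet_Icc
  have hlogm : Measurable fun z => ‖log ‖f z‖‖ₑ := (hm.norm.log).enorm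
  have hsum : ∑ a ∈ S, |(orderInt f a : ℝ)| ≤ 2 * R * M / h := by
    have h1 := hMr.2.2 ρ (by linarith) S (fun z hz => ((hS z).1 hz).1)
    rw [show r + h - ρ = h / 2 by rw [hρ]; ring] at h1
    rw [le_div_iff₀ hh]
    have h2 : (∑ a ∈ S, |(orderInt f a : ℝ)|) * (h / 2 / R) * (2 * R) ≤ M * (2 * R) := by gcongr
    calc (∑ a ∈ S, |(orderInt f a : ℝ)|) * h
        = (∑ a ∈ S, |(orderInt f a : ℝ)|) * (h / 2 / R) * (2 * R) := by field_simp
      _ ≤ M * (2 * R) := h2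
      _ = 2 * R * M := by ring
  have hwide : ∫⁻ z in {z : ℂ | ‖z‖ ∈ Icc (r - t) (r + h / 4 + t)}, ‖log ‖f z‖‖ₑ
      ≤ ENNReal.ofReal (R * (2 * π * M) * (h / 4 + 2 * t)) := by
    rw [setLIntegral_annulus hlogm measurableSet_Icc
      (fun x hx => lt_of_lt_of_le (by linarith) hx.1)]
    have h1 : ∀ τ ∈ Icc (r - t) (r + h / 4 + t),
        ENNReal.ofReal τ * ∫⁻ θ in Ioc 0 (2 * π), ‖log ‖f (circleMap 0 τ θ)‖‖ₑ
        ≤ ENNReal.ofReal (R * (2 * π * M)) := by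
      intro τ hτ
      have hτ0 : 0 < τ := lt_of_lt_of_le (by linarith) hτ.1
      have hτh : τ ≤ r + h := by linarith [hτ.2]
      have hτR : τ < R := by linarith
      have h2 := (hbd τ (by linarith [hτ.1]) hτR).2.1
      have h3 := nevanlinnaT_mono hm hf hτ0 hτh hrh
      rw [lintegral_enorm_log_norm_circleMap (hf.sphere_of_ball hτ0 hτR),
        ← ENNReal.ofReal_mul hτ0.le]
      apply ENNReal.ofReal_le_ofReal
      have h4 : circleAverage (fun z => |log ‖f z‖|) 0 τ ≤ M := by rw [hM]; linarith
      have h5 : 0 ≤ circleAverage (fun z => |log ‖f z‖|) 0 τ :=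
        circleAverage_nonneg_of_nonneg fun z _ => abs_nonneg _
      gcongr
    refine (setLIntegral_mono measurable_const h1).trans ?_
    rw [lintegral_const, Measure.restrict_apply_univ, Real.volume_Icc,
      ← ENNReal.ofReal_mul (by positivity)]
    apply ENNReal.ofReal_le_ofReal
    apply le_of_eq
    ring
  calc ∫⁻ z in A, ‖logDeriv f z‖ₑ
      ≤ ∫⁻ c in A, (ENNReal.ofReal (1 / (π * t)) *
          (∫⁻ θ in Ioc 0 (2 * π), ‖log ‖f (circleMap c t θ)‖‖ₑ) +
        ∑ a ∈ S, ‖(orderInt f a : ℝ)‖ₑ *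
          (ball a t).indicator (fun z => ‖z - a‖ₑ⁻¹) c) := by
        refine setLIntegral_mono_ae' hAm ?_
        filter_upwards [hae] with c hc hcA
        refine (hc ?_).trans (le_of_eq ?_)
        · intro w hw
          rw [mem_closedBall, dist_eq_norm] at hw
          rw [mem_closedBall_zero_iff]
          have := norm_add_le (w - c) c
          rw [sub_add_cancel] at this
          linarith [hcA.2]
        · congr 1
          refine Finset.sum_congr rfl fun a ha => ?_
          rw [divisor_closedBall_of_norm_le hfρ ((hS a).1 ha).1]
    _ = ENNReal.ofReal (1 / (π * t)) *
          (∫⁻ c in A, ∫⁻ θ in Ioc 0 (2 * π), ‖log ‖f (circleMap c t θ)‖‖ₑ) +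
        ∑ a ∈ S, ‖(orderInt f a : ℝ)‖ₑ *
          ∫⁻ c in A, (ball a t).indicator (fun z => ‖z - a‖ₑ⁻¹) c := by
        have hind : ∀ a : ℂ, Measurable ((ball a t).indicator (fun z => ‖z - a‖ₑ⁻¹)) :=
          fun a => ((measurable_id.sub_const a).enorm.inv).indicator measurableSet_ball
        rw [lintegral_add_right _ (Finset.measurable_fun_sum _ fun a _ => (hind a).const_mul _),
          lintegral_const_mul' _ _ ENNReal.ofReal_ne_top,
          lintegral_finsetSum _ fun a _ => (hind a).const_mul _]
        congr 1
        exact Finset.sum_congr rfl fun a _ => lintegral_const_mul' _ _ enorm_ne_top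
    _ ≤ ENNReal.ofReal (1 / (π * t)) * (ENNReal.ofReal (2 * π) *
          ENNReal.ofReal (R * (2 * π * M) * (h / 4 + 2 * t))) +
        ∑ a ∈ S, ENNReal.ofReal |(orderInt f a : ℝ)| * ENNReal.ofReal (2 * π * t) := by
        refine add_le_add (mul_le_mul_right ?_ _) (Finset.sum_le_sum fun a _ => ?_)
        · exact (setLIntegral_lintegral_circleMap_le hlogm ht0.le).trans
            (mul_le_mul_right hwide _)
        · rw [← ofReal_norm, Real.norm_eq_abs, ← lintegral_indicator_ball_inv a t]
          exact mul_le_mul_right (setLIntegral_le_lintegral _ _) _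
    _ = ENNReal.ofReal (1 / (π * t) * (2 * π * (R * (2 * π * M) * (h / 4 + 2 * t))) +
          (∑ a ∈ S, |(orderInt f a : ℝ)|) * (2 * π * t)) := by
        rw [← Finset.sum_mul, ← ENNReal.ofReal_sum_of_nonneg fun a _ => abs_nonneg _,
          ← ENNReal.ofReal_mul (by positivity), ← ENNReal.ofReal_mul (by positivity),
          ← ENNReal.ofReal_mul (Finset.sum_nonneg fun a _ => abs_nonneg _),
          ← ENNReal.ofReal_add (by positivity)]
        exact mul_nonneg (Finset.sum_nonneg fun a _ => abs_nonneg _) (by positivity)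
    _ ≤ ENNReal.ofReal ((K + C₀) * (nevanlinnaT f (r + h) + (K + C₀))) := by
        apply ENNReal.ofReal_le_ofReal
        calc 1 / (π * t) * (2 * π * (R * (2 * π * M) * (h / 4 + 2 * t))) +
              (∑ a ∈ S, |(orderInt f a : ℝ)|) * (2 * π * t)
            ≤ 1 / (π * t) * (2 * π * (R * (2 * π * M) * (h / 4 + 2 * t))) +
              (2 * R * M / h) * (2 * π * t) := by gcongr
          _ = (K / 2) * M := by
              rw [hK, ht]
              field_simp
              ring
          _ ≤ (K / 2) * (2 * (nevanlinnaT f (r + h) + (K + C₀))) := by gcongr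
          _ ≤ (K + C₀) * (nevanlinnaT f (r + h) + (K + C₀)) := by nlinarith

/-! ### Circular means and the characteristic of derivatives -/

lemma measurable_lintegral_circleMap {u : ℂ → ENNReal} (hu : Measurable u) :
    Measurable fun τ : ℝ => ∫⁻ θ in Ioc 0 (2 * π), u (circleMap 0 τ θ) := by
  have hcm : Measurable fun p : ℝ × ℝ => circleMap 0 p.1 p.2 := by
    unfold circleMap; fun_prop
  exact (hu.comp hcm).lintegral_prod_right'

/-- The area bound as an integral over radii; the weight `τ` of polar coordinates is dropped,
because `τ ≥ r₁ > 0`. -/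
lemma exists_setLIntegral_circleMap_logDeriv_le {f : ℂ → ℂ} {R r₁ : ℝ} (hm : Measurable f)
    (hf : MeromorphicOn f (ball 0 R)) (hord : ∀ z ∈ ball (0 : ℂ) R, meromorphicOrderAt f z ≠ ⊤)
    (hr₁ : 0 < r₁) (hr₁R : r₁ < R) :
    ∃ C > 0, ∀ r h, r₁ ≤ r → 0 < h → r + h < R → 0 ≤ nevanlinnaT f (r + h) + C ∧
      ∫⁻ τ in Icc r (r + h / 4), ∫⁻ θ in Ioc 0 (2 * π), ‖logDeriv f (circleMap 0 τ θ)‖ₑ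
        ≤ ENNReal.ofReal (C * (nevanlinnaT f (r + h) + C)) := by
  obtain ⟨C, hC, hbd⟩ := exists_setLIntegral_logDeriv_le hm hf hord hr₁ hr₁R
  refine ⟨C + C / r₁, by positivity, fun r h hr hh hrh => ?_⟩
  obtain ⟨h0, h1⟩ := hbd r h hr hh hrh
  have hCr : 0 < C / r₁ := by positivity
  refine ⟨by linarith, ?_⟩
  have hldm : Measurable fun z => ‖logDeriv f z‖ₑ := ((measurable_deriv f).div hm).enorm
  rw [setLIntegral_annulus hldm measurableSet_Icc
    (fun x hx => lt_of_lt_of_le (hr₁.trans_le hr) hx.1)] at h1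
  have h2 : ENNReal.ofReal r₁ *
      ∫⁻ τ in Icc r (r + h / 4), ∫⁻ θ in Ioc 0 (2 * π), ‖logDeriv f (circleMap 0 τ θ)‖ₑ
      ≤ ENNReal.ofReal (C * (nevanlinnaT f (r + h) + C)) := by
    rw [← lintegral_const_mul' _ _ ENNReal.ofReal_ne_top]
    refine (setLIntegral_mono' measurableSet_Icc fun τ hτ => ?_).trans h1
    gcongr
    exact hr.trans hτ.1
  rw [mul_comm, ← ENNReal.le_div_iff_mul_le (Or.inl (by simpa using hr₁))
    (Or.inl ENNReal.ofReal_ne_top), ← ENNReal.ofReal_div_of_pos hr₁] at h2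
  refine h2.trans (ENNReal.ofReal_le_ofReal ?_)
  calc C * (nevanlinnaT f (r + h) + C) / r₁ = C / r₁ * (nevanlinnaT f (r + h) + C) := by ring
    _ ≤ (C + C / r₁) * (nevanlinnaT f (r + h) + (C + C / r₁)) := by
      apply mul_le_mul <;> linarith

/-- Concavity of the logarithm: the proximity function is bounded by the logarithm of the mean
modulus. -/
lemma proximity_le_log_one_add {u : ℂ → ℂ} {ρ m : ℝ} (hu : Measurable u)
    (hmer : MeromorphicOn u (sphere 0 |ρ|)) (hm : 0 ≤ m)
    (h : ∫⁻ θ in Ioc 0 (2 * π), ‖u (circleMap 0 ρ θ)‖ₑ ≤ ENNReal.ofReal (2 * π * m)) :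
    ValueDistribution.proximity u ⊤ ρ ≤ log (1 + m) := by
  have hcm : Measurable fun θ : ℝ => circleMap 0 ρ θ := by
    unfold circleMap; fun_prop
  have hint : IntegrableOn (fun θ => u (circleMap 0 ρ θ)) (Ioc 0 (2 * π)) :=
    ⟨(hu.comp hcm).aestronglyMeasurable, h.trans_lt ENNReal.ofReal_lt_top⟩
  have hci : CircleIntegrable (fun z => ‖u z‖) 0 ρ := by
    rw [CircleIntegrable, intervalIntegrable_iff_integrableOn_Ioc_of_le two_pi_pos.le]
    exact hint.norm
  have hmean : circleAverage (fun z => ‖u z‖) 0 ρ ≤ m := by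
    rw [circleAverage_def, smul_eq_mul, intervalIntegral.integral_of_le two_pi_pos.le,
      inv_mul_le_iff₀ two_pi_pos, ← ENNReal.ofReal_le_ofReal_iff (by positivity)]
    rwa [ofReal_integral_norm_eq_lintegral_enorm hint]
  rw [ValueDistribution.proximity_top]
  have hci' : CircleIntegrable (fun z => (log (1 + m) - m / (1 + m)) + (1 + m)⁻¹ * ‖u z‖) 0 ρ :=
    (circleIntegrable_const _ _ _).add (IntervalIntegrable.const_mul hci _)
  refine (circleAverage_mono hmer.circleIntegrable_posLog_norm hci' fun z _ => ?_).trans ?_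
  · have h1 : log⁺ ‖u z‖ ≤ log (1 + ‖u z‖) := by
      rw [posLog_eq_log_max_one (norm_nonneg _)]
      exact log_le_log (by positivity) (max_le (by linarith [norm_nonneg (u z)]) (by linarith))
    have h2 : log ((1 + ‖u z‖) / (1 + m)) ≤ (1 + ‖u z‖) / (1 + m) - 1 :=
      log_le_sub_one_of_pos (by positivity)
    rw [log_div (by positivity) (by positivity)] at h2
    have h3 : (1 + ‖u z‖) / (1 + m) - 1 = (1 + m)⁻¹ * ‖u z‖ - m / (1 + m) := by
      field_simp
      ring
    linarith
  · have h4 := circleAverage_fun_add (circleIntegrable_const (log (1 + m) - m / (1 + m)) 0 ρ)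
      (f₂ := fun z => (1 + m)⁻¹ * ‖u z‖) (IntervalIntegrable.const_mul hci _)
    have h5 : circleAverage (fun z => (1 + m)⁻¹ * ‖u z‖) 0 ρ
        = (1 + m)⁻¹ * circleAverage (fun z => ‖u z‖) 0 ρ :=
      circleAverage_fun_smul (a := (1 + m)⁻¹) (f := fun z => ‖u z‖)
    rw [h4, circleAverage_const, h5]
    have h6 : (1 + m)⁻¹ * circleAverage (fun z => ‖u z‖) 0 ρ ≤ (1 + m)⁻¹ * m := by gcongr
    have h7 : (1 + m)⁻¹ * m = m / (1 + m) := by ring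
    linarith

lemma proximity_deriv_le {f : ℂ → ℂ} {ρ : ℝ} (hρ : 0 < ρ)
    (hf : MeromorphicOn f (sphere 0 |ρ|))
    (hord : ∀ z ∈ sphere (0 : ℂ) |ρ|, meromorphicOrderAt f z ≠ ⊤) :
    ValueDistribution.proximity (deriv f) ⊤ ρ
      ≤ ValueDistribution.proximity f ⊤ ρ + ValueDistribution.proximity (logDeriv f) ⊤ ρ := by
  have hld : MeromorphicOn (logDeriv f) (sphere 0 |ρ|) := hf.deriv.div hf
  simp only [ValueDistribution.proximity_top]
  have h1 : circleAverage (fun z => log⁺ ‖deriv f z‖) 0 ρ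
      = circleAverage (fun z => log⁺ (‖f z‖ * ‖logDeriv f z‖)) 0 ρ := by
    refine circleAverage_congr_codiscreteWithin ?_ hρ.ne'
    filter_upwards [hf.eventually_codiscreteWithin_apply_ne_zero hord] with z hz
    rw [← norm_mul, logDeriv_apply, mul_div_cancel₀ _ hz]
  have h2 : CircleIntegrable (fun z => log⁺ (‖f z‖ * ‖logDeriv f z‖)) 0 ρ := by
    have := (hf.mul hld).circleIntegrable_posLog_norm
    simpa only [Pi.mul_apply, norm_mul] using this
  rw [h1, ← circleAverage_fun_add hf.circleIntegrable_posLog_norm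
    hld.circleIntegrable_posLog_norm]
  exact circleAverage_mono h2
    (hf.circleIntegrable_posLog_norm.add hld.circleIntegrable_posLog_norm)
    fun z _ => posLog_mul

/-- A good radius: somewhere on an interval a function is at most twice its mean. -/
lemma exists_mem_Icc_le_of_setLIntegral_le {I : ℝ → ENNReal} {a w Y : ℝ} (hw : 0 < w) (hY : 0 < Y)
    (h : ∫⁻ τ in Icc a (a + w), I τ ≤ ENNReal.ofReal Y) :
    ∃ τ ∈ Icc a (a + w), I τ ≤ ENNReal.ofReal (2 * Y / w) := by
  by_contra! hcon
  have h1 : ∫⁻ _ in Icc a (a + w), ENNReal.ofReal (2 * Y / w) ≤ ENNReal.ofReal Y :=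
    (setLIntegral_mono' measurableSet_Icc fun τ hτ => (hcon τ hτ).le).trans h
  rw [lintegral_const, Measure.restrict_apply_univ, Real.volume_Icc, add_sub_cancel_left,
    ← ENNReal.ofReal_mul (by positivity), ENNReal.ofReal_le_ofReal_iff hY.le,
    div_mul_cancel₀ _ hw.ne'] at h1
  linarith

/-- The characteristic of the derivative. No exceptional set occurs, because the bound at a good
radius is carried over to smaller radii by monotonicity. -/
lemma exists_nevanlinnaT_deriv_le {f : ℂ → ℂ} {R r₁ : ℝ} (hm : Measurable f)
    (hf : MeromorphicOn f (ball 0 R)) (hord : ∀ z ∈ ball (0 : ℂ) R, meromorphicOrderAt f z ≠ ⊤)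
    (hr₁ : 0 < r₁) (hr₁R : r₁ < R) :
    ∃ C > 0, ∀ r h, r₁ ≤ r → 0 < h → r + h < R →
      0 ≤ nevanlinnaT f (r + h) + C ∧
      nevanlinnaT (deriv f) r ≤ C * (nevanlinnaT f (r + h) + log (R / h) + C) := by
  obtain ⟨C₁, hC₁, hbd⟩ := exists_setLIntegral_circleMap_logDeriv_le hm hf hord hr₁ hr₁R
  obtain ⟨C₂, hC₂, hN⟩ := exists_poleCounting_deriv_le hf hr₁
  have hR : 0 < R := hr₁.trans hr₁R
  set K := 2 + 2 * C₁ / R + C₁ + C₂ + 2 / R with hK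
  have e1 : 0 < 2 * C₁ / R := by positivity
  have e2 : 0 < 2 / R := by positivity
  refine ⟨K, by positivity, fun r h hr hh hrh => ?_⟩
  obtain ⟨hX, hI⟩ := hbd r h hr hh hrh
  have hr0 : 0 < r := hr₁.trans_le hr
  refine ⟨by linarith, ?_⟩
  set X := nevanlinnaT f (r + h) + C₁ with hXdef
  set Y := C₁ * X + 1 with hY
  have hY0 : 0 < Y := by positivity
  obtain ⟨ρ, hρ, hρI⟩ := exists_mem_Icc_le_of_setLIntegral_le (by positivity : 0 < h / 4) hY0
    (hI.trans (ENNReal.ofReal_le_ofReal (by linarith)))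
  have hρ0 : 0 < ρ := hr0.trans_le hρ.1
  have hρh : ρ ≤ r + h := by linarith [hρ.2]
  have hρR : ρ < R := by linarith
  have hsph := hf.sphere_of_ball hρ0 hρR
  have hsph' : sphere (0 : ℂ) |ρ| ⊆ ball 0 R := by
    rw [abs_of_pos hρ0]
    exact sphere_subset_closedBall.trans (closedBall_subset_ball hρR)
  have hldm : Measurable (logDeriv f) := (measurable_deriv f).div hm
  have hprox : ValueDistribution.proximity (logDeriv f) ⊤ ρ ≤ log (1 + 2 * Y / h) := by
    refine proximity_le_log_one_add hldm (hsph.deriv.div hsph) (by positivity) (hρI.trans ?_)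
    apply ENNReal.ofReal_le_ofReal
    have h3 : 2 * Y / (h / 4) = 4 * (2 * Y / h) := by field_simp
    rw [h3]
    have h4 : (0 : ℝ) ≤ 2 * Y / h := by positivity
    nlinarith [pi_gt_three]
  have hlog : log (1 + 2 * Y / h) ≤ log (R / h) + 2 * Y / R := by
    have h3 : 1 + 2 * Y / h = R / h * (h / R + 2 * Y / R) := by field_simp
    have h4 : h / R ≤ 1 := by rw [div_le_one hR]; linarith
    rw [h3, log_mul (by positivity) (by positivity)]
    have h5 := log_le_sub_one_of_pos (by positivity : 0 < h / R + 2 * Y / R)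
    linarith
  have hL : 0 ≤ log (R / h) := log_nonneg (by rw [one_le_div hh]; linarith)
  have hT1 := nevanlinnaT_mono (measurable_deriv f) hf.deriv hr0 hρ.1 hρR
  have hT2 := nevanlinnaT_mono hm hf hρ0 hρh hrh
  have hprox2 := proximity_deriv_le hρ0 hsph fun z hz => hord z (hsph' hz)
  have hN' := hN ρ (hr.trans hρ.1) hρR
  have hpos : 0 ≤ ValueDistribution.proximity f ⊤ ρ := by
    rw [ValueDistribution.proximity_top]
    exact circleAverage_nonneg_of_nonneg fun z _ => posLog_nonneg
  have h6 : nevanlinnaT (deriv f) r ≤ 2 * X + C₂ + log (R / h) + 2 * Y / R := by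
    have h7 : nevanlinnaT (deriv f) ρ
        = ValueDistribution.proximity (deriv f) ⊤ ρ + poleCounting (deriv f) ρ := rfl
    have h8 : nevanlinnaT f ρ = ValueDistribution.proximity f ⊤ ρ + poleCounting f ρ := rfl
    linarith
  have h9 : 2 * Y / R = 2 * C₁ / R * X + 2 / R := by rw [hY]; ring
  have h10 : nevanlinnaT f (r + h) + log (R / h) + K = X + log (R / h) + (K - C₁) := by
    rw [hXdef]; ring
  rw [h10]
  have hK1 : 1 ≤ K := by rw [hK]; linarith
  have h11 : (2 + 2 * C₁ / R) * X ≤ K * X := by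
    apply mul_le_mul_of_nonneg_right _ hX
    rw [hK]; linarith
  have h12 : 1 * log (R / h) ≤ K * log (R / h) := mul_le_mul_of_nonneg_right hK1 hL
  have h13 : 1 * (K - C₁) ≤ K * (K - C₁) :=
    mul_le_mul_of_nonneg_right hK1 (by rw [hK]; linarith)
  have h14 : C₂ + 2 / R ≤ K - C₁ := by rw [hK]; linarith
  linarith

lemma MeromorphicOn.iteratedDeriv {f : ℂ → ℂ} {U : Set ℂ} (hf : MeromorphicOn f U) (n : ℕ) :
    MeromorphicOn (_root_.iteratedDeriv n f) U := by
  induction n with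
  | zero => simpa using hf
  | succ n ih => rw [iteratedDeriv_succ]; exact ih.deriv

lemma measurable_iteratedDeriv_of_measurable {f : ℂ → ℂ} (hm : Measurable f) (n : ℕ) :
    Measurable (iteratedDeriv n f) := by
  cases n with
  | zero => simpa using hm
  | succ n => rw [iteratedDeriv_succ]; exact measurable_deriv _

lemma logDeriv_iteratedDeriv (f : ℂ → ℂ) (n : ℕ) (z : ℂ) :
    logDeriv (iteratedDeriv n f) z = iteratedDeriv (n + 1) f z / iteratedDeriv n f z := by
  rw [logDeriv_apply, iteratedDeriv_succ]

/-- Each differentiation uses up half of the remaining distance `h`, which changes only the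
constants. -/
lemma exists_nevanlinnaT_iteratedDeriv_le {f : ℂ → ℂ} {R r₁ : ℝ} (hm : Measurable f)
    (hf : MeromorphicOn f (ball 0 R)) (hr₁ : 0 < r₁) (hr₁R : r₁ < R) (n : ℕ)
    (hord : ∀ i < n + 1, ∀ z ∈ ball (0 : ℂ) R, meromorphicOrderAt (iteratedDeriv i f) z ≠ ⊤) :
    ∃ C > 0, ∀ r h, r₁ ≤ r → 0 < h → r + h < R → 0 ≤ nevanlinnaT f (r + h) + C ∧
      nevanlinnaT (iteratedDeriv n f) r ≤ C * (nevanlinnaT f (r + h) + log (R / h) + C) := by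
  have hR : 0 < R := hr₁.trans hr₁R
  induction n with
  | zero =>
    obtain ⟨C₀, hC₀, hbd⟩ := exists_circleAverage_abs_log_norm_le hf hr₁
    refine ⟨C₀ + 1, by positivity, fun r h hr hh hrh => ?_⟩
    have h1 := (hbd (r + h) (by linarith) hrh).1
    refine ⟨by linarith, ?_⟩
    have h2 := nevanlinnaT_mono hm hf (hr₁.trans_le hr) (by linarith : r ≤ r + h) hrh
    have hL : 0 ≤ log (R / h) := log_nonneg (by rw [one_le_div hh]; linarith)
    rw [iteratedDeriv_zero]
    nlinarith
  | succ n ih =>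
    obtain ⟨C, hC, hbd⟩ := ih fun i hi => hord i (by omega)
    have ho := hord n (by omega)
    obtain ⟨C', hC', hbd'⟩ := exists_nevanlinnaT_deriv_le
      (measurable_iteratedDeriv_of_measurable hm n) (hf.iteratedDeriv n) ho hr₁ hr₁R
    have hl2 : 0 < log 2 := log_pos one_lt_two
    set K := C' * C + C' + C + C' * C * log 2 + C' * C * C + C' * log 2 + C' * C' + 1 with hK
    refine ⟨K, by positivity, fun r h hr hh hrh => ?_⟩
    obtain ⟨hX, h1⟩ := hbd (r + h / 2) (h / 2) (by linarith) (by positivity) (by linarith)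
    obtain ⟨-, h2⟩ := hbd' r (h / 2) hr (by positivity) (by linarith)
    rw [show r + h / 2 + h / 2 = r + h by ring] at hX h1
    have hlog : log (R / (h / 2)) = log (R / h) + log 2 := by
      rw [← log_mul (by positivity) (by positivity)]
      congr 1
      field_simp
    have hL : 0 ≤ log (R / h) := log_nonneg (by rw [one_le_div hh]; linarith)
    rw [hlog] at h1 h2
    have hKC : C ≤ K := by
      rw [hK]
      have : 0 ≤ C' * C + C' + C' * C * log 2 + C' * C * C + C' * log 2 + C' * C' + 1 := by
        positivity
      linarith
    refine ⟨by linarith, ?_⟩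
    rw [iteratedDeriv_succ]
    set T := nevanlinnaT f (r + h)
    set L := log (R / h)
    have h3 : C' * (nevanlinnaT (iteratedDeriv n f) (r + h / 2) + (L + log 2) + C')
        ≤ C' * (C * (T + (L + log 2) + C) + (L + log 2) + C') := by
      gcongr
    refine (h2.trans h3).trans ?_
    have h4 : C' * (C * (T + (L + log 2) + C) + (L + log 2) + C')
        = C' * C * (T + C) + (C' * C + C') * L
          + (C' * C * log 2 + C' * log 2 + C' * C') := by ring
    have h5 : K * (T + L + K) = K * (T + C) + K * L + K * (K - C) := by ring
    rw [h4, h5]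
    have p1 : 0 < C' * C := by positivity
    have p2 : 0 < C' * C * log 2 := by positivity
    have p3 : 0 < C' * C * C := by positivity
    have p4 : 0 < C' * log 2 := by positivity
    have p5 : 0 < C' * C' := by positivity
    have h6 : C' * C * (T + C) ≤ K * (T + C) :=
      mul_le_mul_of_nonneg_right (by rw [hK]; linarith) hX
    have h7 : (C' * C + C') * L ≤ K * L := mul_le_mul_of_nonneg_right (by rw [hK]; linarith) hL
    have h8 : 1 * (K - C) ≤ K * (K - C) :=
      mul_le_mul_of_nonneg_right (by rw [hK]; linarith) (by linarith)
    have h9 : C' * C * log 2 + C' * log 2 + C' * C' ≤ K - C := by rw [hK]; linarith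
    linarith

/-- Area bound for the logarithmic derivative of a higher derivative, in terms of the
characteristic of the function itself. -/
lemma exists_setLIntegral_logDeriv_iteratedDeriv_le {f : ℂ → ℂ} {R r₁ : ℝ} (hm : Measurable f)
    (hf : MeromorphicOn f (ball 0 R)) (hr₁ : 0 < r₁) (hr₁R : r₁ < R) (n : ℕ)
    (hord : ∀ i < n + 1, ∀ z ∈ ball (0 : ℂ) R, meromorphicOrderAt (iteratedDeriv i f) z ≠ ⊤) :
    ∃ C > 0, ∀ r h, r₁ ≤ r → 0 < h → r + h < R → 0 ≤ nevanlinnaT f (r + h) + C ∧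
      ∫⁻ τ in Icc r (r + h / 8), ∫⁻ θ in Ioc 0 (2 * π),
          ‖logDeriv (iteratedDeriv n f) (circleMap 0 τ θ)‖ₑ
        ≤ ENNReal.ofReal (C * (nevanlinnaT f (r + h) + log (R / h) + C)) := by
  have hR : 0 < R := hr₁.trans hr₁R
  obtain ⟨C, hC, hbd⟩ := exists_nevanlinnaT_iteratedDeriv_le hm hf hr₁ hr₁R n hord
  obtain ⟨C', hC', hbd'⟩ := exists_setLIntegral_circleMap_logDeriv_le
    (measurable_iteratedDeriv_of_measurable hm n) (hf.iteratedDeriv n) (hord n (by omega)) hr₁ hr₁R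
  have hl2 : 0 < log 2 := log_pos one_lt_two
  set K := C' * C + C + C' * C * log 2 + C' * C' + 1 with hK
  have p1 : 0 < C' * C := by positivity
  have p2 : 0 < C' * C * log 2 := by positivity
  have p5 : 0 < C' * C' := by positivity
  refine ⟨K, by positivity, fun r h hr hh hrh => ?_⟩
  obtain ⟨hX, h1⟩ := hbd (r + h / 2) (h / 2) (by linarith) (by positivity) (by linarith)
  obtain ⟨-, h2⟩ := hbd' r (h / 2) hr (by positivity) (by linarith)
  rw [show r + h / 2 + h / 2 = r + h by ring] at hX h1
  rw [show h / 2 / 4 = h / 8 by ring] at h2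
  have hlog : log (R / (h / 2)) = log (R / h) + log 2 := by
    rw [← log_mul (by positivity) (by positivity)]
    congr 1
    field_simp
  have hL : 0 ≤ log (R / h) := log_nonneg (by rw [one_le_div hh]; linarith)
  rw [hlog] at h1
  refine ⟨by rw [hK]; linarith, h2.trans (ENNReal.ofReal_le_ofReal ?_)⟩
  set T := nevanlinnaT f (r + h)
  set L := log (R / h)
  have h3 : C' * (nevanlinnaT (iteratedDeriv n f) (r + h / 2) + C')
      ≤ C' * (C * (T + (L + log 2) + C) + C') := by gcongr
  refine h3.trans ?_
  have h4 : C' * (C * (T + (L + log 2) + C) + C')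
      = C' * C * (T + C) + C' * C * L + (C' * C * log 2 + C' * C') := by ring
  have h5 : K * (T + L + K) = K * (T + C) + K * L + K * (K - C) := by ring
  rw [h4, h5]
  have h6 : C' * C * (T + C) ≤ K * (T + C) :=
    mul_le_mul_of_nonneg_right (by rw [hK]; linarith) hX
  have h7 : C' * C * L ≤ K * L := mul_le_mul_of_nonneg_right (by rw [hK]; linarith) hL
  have h8 : 1 * (K - C) ≤ K * (K - C) :=
    mul_le_mul_of_nonneg_right (by rw [hK]; linarith) (by rw [hK]; linarith)
  have h9 : C' * C * log 2 + C' * C' ≤ K - C := by rw [hK]; linarith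
  linarith

/-! ### Means of quotients of derivatives -/

lemma meromorphicOrderAt_ne_top_of_deriv {f : ℂ → ℂ} {z : ℂ}
    (h : meromorphicOrderAt (deriv f) z ≠ ⊤) : meromorphicOrderAt f z ≠ ⊤ := by
  intro htop
  refine h (meromorphicOrderAt_eq_top_iff.2 ?_)
  have h1 : f =ᶠ[𝓝[≠] z] fun _ => 0 := meromorphicOrderAt_eq_top_iff.1 htop
  filter_upwards [h1.nhdsNE_deriv] with w hw
  rw [hw, deriv_const]

lemma meromorphicOrderAt_iteratedDeriv_ne_top_of_le {f : ℂ → ℂ} {z : ℂ} {i k : ℕ} (hik : i ≤ k)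
    (h : meromorphicOrderAt (iteratedDeriv k f) z ≠ ⊤) :
    meromorphicOrderAt (iteratedDeriv i f) z ≠ ⊤ := by
  induction k, hik using Nat.le_induction with
  | base => exact h
  | succ k _ ih =>
    rw [iteratedDeriv_succ] at h
    exact ih (meromorphicOrderAt_ne_top_of_deriv h)

lemma ae_circleMap_of_codiscreteWithin_sphere {p : ℂ → Prop} {r : ℝ} (hr : r ≠ 0)
    (h : ∀ᶠ z in codiscreteWithin (sphere (0 : ℂ) |r|), p z) :
    ∀ᵐ θ ∂(volume.restrict (Ioc 0 (2 * π))), p (circleMap 0 r θ) := by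
  apply ae_restrict_le_codiscreteWithin measurableSet_Ioc
  exact codiscreteWithin_mono (subset_univ _) (circleMap_preimage_codiscrete hr h)

/-- The mean over the circle of radius `r` of `|f⁽ᵏ⁾ / f⁽ʲ⁾|^{1 / (k - j)}`, up to the factor
`2π`, with values in `[0, ∞]`. -/
noncomputable def quotientMean (f : ℂ → ℂ) (j k : ℕ) (r : ℝ) : ENNReal :=
  ∫⁻ θ in Ioc 0 (2 * π), ENNReal.ofReal
    (‖iteratedDeriv k f (circleMap 0 r θ) / iteratedDeriv j f (circleMap 0 r θ)‖
      ^ (1 / ((k : ℝ) - (j : ℝ))))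

lemma measurable_norm_div_rpow {f : ℂ → ℂ} (hm : Measurable f) (j k : ℕ) (p : ℝ) :
    Measurable fun z => ‖iteratedDeriv k f z / iteratedDeriv j f z‖ ^ p :=
  (((measurable_iteratedDeriv_of_measurable hm k).div
    (measurable_iteratedDeriv_of_measurable hm j)).norm).pow_const p

lemma measurable_quotientMean {f : ℂ → ℂ} (hm : Measurable f) (j k : ℕ) :
    Measurable (quotientMean f j k) :=
  measurable_lintegral_circleMap (measurable_norm_div_rpow hm j k _).ennreal_ofReal

lemma logDerivMeanLE_of_quotientMean_le {f : ℂ → ℂ} (hm : Measurable f) {j k : ℕ} {r B : ℝ}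
    (hB : 0 ≤ B) (h : quotientMean f j k r ≤ ENNReal.ofReal B) : LogDerivMeanLE f j k r B := by
  have hcm : Measurable fun θ : ℝ => circleMap 0 r θ := by
    unfold circleMap; fun_prop
  have hmeas : Measurable fun θ : ℝ =>
      ‖iteratedDeriv k f (circleMap 0 r θ) / iteratedDeriv j f (circleMap 0 r θ)‖
        ^ (1 / ((k : ℝ) - (j : ℝ))) := (measurable_norm_div_rpow hm j k _).comp hcm
  have hnn : ∀ θ : ℝ, 0 ≤
      ‖iteratedDeriv k f (circleMap 0 r θ) / iteratedDeriv j f (circleMap 0 r θ)‖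
        ^ (1 / ((k : ℝ) - (j : ℝ))) := fun θ => rpow_nonneg (norm_nonneg _) _
  constructor
  · rw [intervalIntegrable_iff_integrableOn_Ioc_of_le two_pi_pos.le]
    refine ⟨hmeas.aestronglyMeasurable, ?_⟩
    rw [hasFiniteIntegral_iff_ofReal (.of_forall hnn)]
    exact h.trans_lt ENNReal.ofReal_lt_top
  · rw [intervalIntegral.integral_of_le two_pi_pos.le,
      integral_eq_lintegral_of_nonneg_ae (.of_forall hnn) hmeas.aestronglyMeasurable]
    exact ENNReal.toReal_le_of_le_ofReal hB h

lemma div_eq_prod_range_div {a : ℕ → ℂ} (j m : ℕ) (h0 : a j ≠ 0)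
    (h : ∀ i < m, a (j + i) ≠ 0) :
    a (j + m) / a j = ∏ i ∈ Finset.range m, a (j + i + 1) / a (j + i) := by
  induction m with
  | zero =>
    simp only [Finset.range_zero, Finset.prod_empty, add_zero, div_self h0]
  | succ m ih =>
    rw [Finset.prod_range_succ, ← ih fun i hi => h i (by omega)]
    have := h m (by omega)
    rw [div_mul_div_comm, mul_comm (a (j + m)), mul_div_mul_right _ _ this, add_assoc]

/-- A geometric mean is at most the sum of its terms. -/
lemma ofReal_norm_prod_rpow_le_sum {m : ℕ} (hm : 0 < m) (x : ℕ → ℂ) :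
    ENNReal.ofReal (‖∏ i ∈ Finset.range m, x i‖ ^ (1 / (m : ℝ)))
      ≤ ∑ i ∈ Finset.range m, ‖x i‖ₑ := by
  have h0 : 0 ≤ ∑ i ∈ Finset.range m, ‖x i‖ := Finset.sum_nonneg fun i _ => norm_nonneg _
  have h1 : ‖∏ i ∈ Finset.range m, x i‖ ≤ (∑ i ∈ Finset.range m, ‖x i‖) ^ m := by
    rw [norm_prod]
    refine (Finset.prod_le_prod (fun i _ => norm_nonneg _) fun i hi =>
      Finset.single_le_sum (f := fun i => ‖x i‖) (fun i _ => norm_nonneg _) hi).trans ?_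
    rw [Finset.prod_const, Finset.card_range]
  have h2 : ‖∏ i ∈ Finset.range m, x i‖ ^ (1 / (m : ℝ)) ≤ ∑ i ∈ Finset.range m, ‖x i‖ := by
    calc ‖∏ i ∈ Finset.range m, x i‖ ^ (1 / (m : ℝ))
        ≤ ((∑ i ∈ Finset.range m, ‖x i‖) ^ m) ^ (1 / (m : ℝ)) := by gcongr
      _ = ∑ i ∈ Finset.range m, ‖x i‖ := by
        rw [one_div, pow_rpow_inv_natCast h0 hm.ne']
  refine (ENNReal.ofReal_le_ofReal h2).trans (le_of_eq ?_)
  rw [ENNReal.ofReal_sum_of_nonneg fun i _ => norm_nonneg _]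
  exact Finset.sum_congr rfl fun i _ => ofReal_norm _

/-- The quotient `f⁽ᵏ⁾ / f⁽ʲ⁾` is the product of `k - j` logarithmic derivatives, so the power
`1 / (k - j)` makes the integrand a geometric mean of their moduli. -/
lemma quotientMean_le_sum {f : ℂ → ℂ} {R : ℝ} (hm : Measurable f) (hf : MeromorphicOn f (ball 0 R))
    {j k : ℕ} (hjk : j < k)
    (hord : ∀ i < k, ∀ z ∈ ball (0 : ℂ) R, meromorphicOrderAt (iteratedDeriv i f) z ≠ ⊤)
    {r : ℝ} (hr : 0 < r) (hrR : r < R) :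
    quotientMean f j k r ≤ ∑ i ∈ Finset.range (k - j),
      ∫⁻ θ in Ioc 0 (2 * π), ‖logDeriv (iteratedDeriv (j + i) f) (circleMap 0 r θ)‖ₑ := by
  have hcm : Measurable fun θ : ℝ => circleMap 0 r θ := by
    unfold circleMap; fun_prop
  have hsph' : sphere (0 : ℂ) |r| ⊆ ball 0 R := by
    rw [abs_of_pos hr]
    exact sphere_subset_closedBall.trans (closedBall_subset_ball hrR)
  have hne : ∀ᵐ θ ∂(volume.restrict (Ioc 0 (2 * π))), ∀ i ∈ Finset.range k,
      iteratedDeriv i f (circleMap 0 r θ) ≠ 0 := by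
    rw [Finset.eventually_all]
    intro i hi
    exact ae_circleMap_of_codiscreteWithin_sphere hr.ne'
      (((hf.iteratedDeriv i).mono_set hsph').eventually_codiscreteWithin_apply_ne_zero
        fun z hz => hord i (Finset.mem_range.1 hi) z (hsph' hz))
  have hmeas : ∀ i, Measurable fun θ : ℝ =>
      ‖logDeriv (iteratedDeriv (j + i) f) (circleMap 0 r θ)‖ₑ := fun i =>
    (((measurable_deriv _).div
      (measurable_iteratedDeriv_of_measurable hm (j + i))).enorm).comp hcm
  rw [← lintegral_finsetSum _ fun i _ => hmeas i]
  refine lintegral_mono_ae ?_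
  filter_upwards [hne] with θ hθ
  have h1 := div_eq_prod_range_div (a := fun i => iteratedDeriv i f (circleMap 0 r θ)) j (k - j)
    (hθ j (Finset.mem_range.2 hjk)) fun i hi => hθ (j + i) (Finset.mem_range.2 (by omega))
  rw [show j + (k - j) = k by omega] at h1
  rw [h1, ← Nat.cast_sub hjk.le]
  simp only [logDeriv_iteratedDeriv]
  exact ofReal_norm_prod_rpow_le_sum (by omega) _

/-- If `f⁽ᵏ⁾` vanishes identically, so does the integrand. -/
lemma quotientMean_eq_zero {f : ℂ → ℂ} {R : ℝ} {j k : ℕ} (hjk : j < k)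
    (htop : ∀ z ∈ ball (0 : ℂ) R, meromorphicOrderAt (iteratedDeriv k f) z = ⊤)
    {r : ℝ} (hr : 0 < r) (hrR : r < R) : quotientMean f j k r = 0 := by
  have hsph' : sphere (0 : ℂ) |r| ⊆ ball 0 R := by
    rw [abs_of_pos hr]
    exact sphere_subset_closedBall.trans (closedBall_subset_ball hrR)
  have h0 : ∀ᶠ z in codiscreteWithin (sphere (0 : ℂ) |r|), iteratedDeriv k f z = 0 := by
    rw [Filter.Eventually, mem_codiscreteWithin]
    intro z hz
    rw [disjoint_principal_right]
    filter_upwards [meromorphicOrderAt_eq_top_iff.1 (htop z (hsph' hz))] with w hw hcon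
    exact hcon.2 hw
  have h1 : (0 : ℝ) < (k : ℝ) - j := by
    rw [sub_pos]; exact_mod_cast hjk
  rw [quotientMean, lintegral_congr_ae, lintegral_zero]
  filter_upwards [ae_circleMap_of_codiscreteWithin_sphere hr.ne' h0] with θ hθ
  rw [hθ, zero_div, norm_zero, zero_rpow (by positivity), ENNReal.ofReal_zero]

/-- The identity theorem: a meromorphic function on a disc vanishes identically near every point
or near none. -/
lemma forall_meromorphicOrderAt_eq_top_or_ne_top {f : ℂ → ℂ} {R : ℝ} (hR : 0 < R)
    (hf : MeromorphicOn f (ball 0 R)) :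
    (∀ z ∈ ball (0 : ℂ) R, meromorphicOrderAt f z = ⊤) ∨
      ∀ z ∈ ball (0 : ℂ) R, meromorphicOrderAt f z ≠ ⊤ := by
  have hconn : IsConnected (ball (0 : ℂ) R) :=
    ⟨⟨0, mem_ball_self hR⟩, (convex_ball 0 R).isPreconnected⟩
  by_cases h : ∃ u : ball (0 : ℂ) R, meromorphicOrderAt f u ≠ ⊤
  · right
    have := (hf.exists_meromorphicOrderAt_ne_top_iff_forall hconn).1 h
    exact fun z hz => this ⟨z, hz⟩
  · left
    push Not at h
    exact fun z hz => h ⟨z, hz⟩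

/-- The area bound for the quotient of derivatives. -/
lemma exists_setLIntegral_quotientMean_le {f : ℂ → ℂ} {R r₁ : ℝ} (hm : Measurable f)
    (hf : MeromorphicOn f (ball 0 R)) (hr₁ : 0 < r₁) (hr₁R : r₁ < R) {j k : ℕ} (hjk : j < k) :
    ∃ C > 0, ∀ r h, r₁ ≤ r → 0 < h → r + h < R → 0 ≤ nevanlinnaT f (r + h) + C ∧
      ∫⁻ τ in Icc r (r + h / 8), quotientMean f j k τ
        ≤ ENNReal.ofReal (C * (nevanlinnaT f (r + h) + log (R / h) + C)) := by
  have hR : 0 < R := hr₁.trans hr₁R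
  rcases forall_meromorphicOrderAt_eq_top_or_ne_top hR (hf.iteratedDeriv k) with htop | hne
  · obtain ⟨C₀, hC₀, hbd⟩ := exists_circleAverage_abs_log_norm_le hf hr₁
    refine ⟨C₀, hC₀, fun r h hr hh hrh => ⟨?_, ?_⟩⟩
    · linarith [(hbd (r + h) (by linarith) hrh).1]
    · rw [setLIntegral_congr_fun measurableSet_Icc (g := fun _ => 0) fun τ hτ =>
        quotientMean_eq_zero hjk htop ((hr₁.trans_le hr).trans_le hτ.1) (by linarith [hτ.2])]
      simp
  have hord : ∀ i < k + 1, ∀ z ∈ ball (0 : ℂ) R, meromorphicOrderAt (iteratedDeriv i f) z ≠ ⊤ :=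
    fun i hi z hz => meromorphicOrderAt_iteratedDeriv_ne_top_of_le (by omega) (hne z hz)
  have hbd := fun i : ℕ => exists_setLIntegral_logDeriv_iteratedDeriv_le hm hf hr₁ hr₁R
    (min (j + i) k) fun l hl => hord l (by omega)
  choose C hC hbd using hbd
  set K := ∑ i ∈ Finset.range (k - j), C i with hK
  have hK0 : 0 < K := Finset.sum_pos (fun i _ => hC i) (by
    rw [Finset.nonempty_range_iff]; omega)
  have hle : ∀ i ∈ Finset.range (k - j), C i ≤ K := fun i hi =>
    Finset.single_le_sum (fun i _ => (hC i).le) hi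
  refine ⟨K, hK0, fun r h hr hh hrh => ?_⟩
  have hL : 0 ≤ log (R / h) := log_nonneg (by rw [one_le_div hh]; linarith)
  have h0 : 0 ∈ Finset.range (k - j) := Finset.mem_range.2 (by omega)
  refine ⟨by linarith [(hbd 0 r h hr hh hrh).1, hle 0 h0], ?_⟩
  have hmeas : ∀ i, Measurable fun τ : ℝ => ∫⁻ θ in Ioc 0 (2 * π),
      ‖logDeriv (iteratedDeriv (j + i) f) (circleMap 0 τ θ)‖ₑ := fun i =>
    measurable_lintegral_circleMap ((measurable_deriv _).div
      (measurable_iteratedDeriv_of_measurable hm (j + i))).enorm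
  calc ∫⁻ τ in Icc r (r + h / 8), quotientMean f j k τ
      ≤ ∫⁻ τ in Icc r (r + h / 8), ∑ i ∈ Finset.range (k - j), ∫⁻ θ in Ioc 0 (2 * π),
          ‖logDeriv (iteratedDeriv (j + i) f) (circleMap 0 τ θ)‖ₑ :=
        setLIntegral_mono' measurableSet_Icc fun τ hτ =>
          quotientMean_le_sum hm hf hjk (fun i hi => hord i (by omega))
            ((hr₁.trans_le hr).trans_le hτ.1) (by linarith [hτ.2])
    _ = ∑ i ∈ Finset.range (k - j), ∫⁻ τ in Icc r (r + h / 8), ∫⁻ θ in Ioc 0 (2 * π),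
          ‖logDeriv (iteratedDeriv (j + i) f) (circleMap 0 τ θ)‖ₑ :=
        lintegral_finsetSum _ fun i _ => hmeas i
    _ ≤ ∑ i ∈ Finset.range (k - j),
          ENNReal.ofReal (C i * (nevanlinnaT f (r + h) + log (R / h) + K)) := by
        refine Finset.sum_le_sum fun i hi => ?_
        have h1 := (hbd i r h hr hh hrh).2
        rw [min_eq_left (by have := Finset.mem_range.1 hi; omega)] at h1
        refine h1.trans (ENNReal.ofReal_le_ofReal ?_)
        have := hle i hi
        have := hC i
        gcongr
    _ = ENNReal.ofReal (K * (nevanlinnaT f (r + h) + log (R / h) + K)) := by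
        rw [← ENNReal.ofReal_sum_of_nonneg, Finset.sum_mul]
        intro i hi
        have := (hbd 0 r h hr hh hrh).1
        have := hle 0 h0
        exact mul_nonneg (hC i).le (by linarith)

/-- For the logarithmic derivative itself the logarithmic term is not needed. -/
lemma exists_setLIntegral_quotientMean_zero_one_le {f : ℂ → ℂ} {R r₁ : ℝ} (hm : Measurable f)
    (hf : MeromorphicOn f (ball 0 R)) (hr₁ : 0 < r₁) (hr₁R : r₁ < R) :
    ∃ C > 0, ∀ r h, r₁ ≤ r → 0 < h → r + h < R → 0 ≤ nevanlinnaT f (r + h) + C ∧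
      ∫⁻ τ in Icc r (r + h / 8), quotientMean f 0 1 τ
        ≤ ENNReal.ofReal (C * (nevanlinnaT f (r + h) + C)) := by
  have hR : 0 < R := hr₁.trans hr₁R
  rcases forall_meromorphicOrderAt_eq_top_or_ne_top hR (hf.iteratedDeriv 1) with htop | hne
  · obtain ⟨C₀, hC₀, hbd⟩ := exists_circleAverage_abs_log_norm_le hf hr₁
    refine ⟨C₀, hC₀, fun r h hr hh hrh => ⟨?_, ?_⟩⟩
    · linarith [(hbd (r + h) (by linarith) hrh).1]
    · rw [setLIntegral_congr_fun measurableSet_Icc (g := fun _ => 0) fun τ hτ =>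
        quotientMean_eq_zero one_pos htop ((hr₁.trans_le hr).trans_le hτ.1) (by linarith [hτ.2])]
      simp
  have hord : ∀ i < 1, ∀ z ∈ ball (0 : ℂ) R, meromorphicOrderAt (iteratedDeriv i f) z ≠ ⊤ :=
    fun i hi z hz => meromorphicOrderAt_iteratedDeriv_ne_top_of_le hi.le (hne z hz)
  obtain ⟨C, hC, hbd⟩ := exists_setLIntegral_circleMap_logDeriv_le hm hf
    (by simpa using hord 0 one_pos) hr₁ hr₁R
  refine ⟨C, hC, fun r h hr hh hrh => ?_⟩
  obtain ⟨h1, h2⟩ := hbd r h hr hh hrh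
  refine ⟨h1, le_trans ?_ h2⟩
  refine (setLIntegral_mono' measurableSet_Icc fun τ hτ => ?_).trans
    (lintegral_mono_set (Icc_subset_Icc_right (by linarith : r + h / 8 ≤ r + h / 4)))
  have h3 := quotientMean_le_sum hm hf one_pos hord
    ((hr₁.trans_le hr).trans_le hτ.1) (by linarith [hτ.2])
  simpa using h3

/-! ### The exceptional set -/

/-- Markov's inequality, in a form without hypotheses on the integral. -/
lemma measure_lintegral_lt_mul_le {α : Type*} [MeasurableSpace α] {μ : Measure α}
    {G : α → ENNReal} (hG : AEMeasurable G μ) (c : ENNReal) :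
    μ {x | ∫⁻ y, G y ∂μ < c * G x} ≤ c := by
  rcases eq_or_ne (∫⁻ y, G y ∂μ) ⊤ with htop | htop
  · simp [htop]
  rcases eq_or_ne (∫⁻ y, G y ∂μ) 0 with hzero | hzero
  · have h0 : ∀ᵐ x ∂μ, ¬ (∫⁻ y, G y ∂μ < c * G x) := by
      filter_upwards [(lintegral_eq_zero_iff' hG).1 hzero] with x hx
      simp [hx]
    have h1 : μ {x | ∫⁻ y, G y ∂μ < c * G x} = 0 := by
      simpa [ae_iff] using h0
    rw [h1]
    exact zero_le
  · set I := ∫⁻ y, G y ∂μ with hI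
    have h1 : I * μ {x | I < c * G x} ≤ I * c := by
      calc I * μ {x | I < c * G x} ≤ I * μ {x | I ≤ c * G x} := by
            gcongr
            exact fun hx => le_of_lt hx
        _ ≤ ∫⁻ x, c * G x ∂μ := mul_meas_ge_le_lintegral₀ (hG.const_mul c) I
        _ = I * c := by rw [lintegral_const_mul'' _ hG, mul_comm]
    exact (ENNReal.mul_le_mul_iff_right hzero htop).1 h1

/-- The partition points `q₀ = a`, `qₙ₊₁ = qₙ + (s qₙ - qₙ) / 8` of `[a, R)`. -/
noncomputable def partitionPoint (s : ℝ → ℝ) (a : ℝ) : ℕ → ℝ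
  | 0 => a
  | n + 1 => partitionPoint s a n + (s (partitionPoint s a n) - partitionPoint s a n) / 8

lemma partitionPoint_mem_Ico {s : ℝ → ℝ} {R a : ℝ} (hs : ∀ r ∈ Ico 0 R, s r ∈ Ioo r R)
    (ha : a ∈ Ico 0 R) (n : ℕ) : partitionPoint s a n ∈ Ico a R := by
  induction n with
  | zero => exact ⟨le_rfl, ha.2⟩
  | succ n ih =>
    have h := hs _ ⟨ha.1.trans ih.1, ih.2⟩
    simp only [partitionPoint]
    exact ⟨by linarith [h.1, ih.1], by linarith [h.2, ih.2]⟩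

/-- The steps of the partition are bounded below on each `[a, r]` with `r < R`, because
`s r - r` is decreasing; so the partition points exhaust `[a, R)`. -/
lemma exists_lt_partitionPoint {s : ℝ → ℝ} {R a : ℝ} (hs : ∀ r ∈ Ico 0 R, s r ∈ Ioo r R)
    (hs_anti : AntitoneOn (fun r => s r - r) (Ico 0 R)) (ha : a ∈ Ico 0 R) {r : ℝ}
    (hr : r ∈ Ico 0 R) : ∃ n, r < partitionPoint s a n := by
  by_contra! hcon
  have hd : 0 < s r - r := sub_pos.2 (hs r hr).1
  have hgrow : ∀ n : ℕ, a + n * ((s r - r) / 8) ≤ partitionPoint s a n := by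
    intro n
    induction n with
    | zero => simp [partitionPoint]
    | succ n ih =>
      have hq := partitionPoint_mem_Ico hs ha n
      have h1 := hs_anti ⟨ha.1.trans hq.1, hq.2⟩ hr (hcon n)
      simp only [partitionPoint, Nat.cast_add, Nat.cast_one] at h1 ⊢
      linarith
  obtain ⟨n, hn⟩ := exists_nat_gt ((r - a) / ((s r - r) / 8))
  rw [div_lt_iff₀ (by positivity)] at hn
  linarith [hgrow n, hcon n]

lemma partitionPoint_strictMono {s : ℝ → ℝ} {R a : ℝ} (hs : ∀ r ∈ Ico 0 R, s r ∈ Ioo r R)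
    (ha : a ∈ Ico 0 R) : StrictMono (partitionPoint s a) := by
  refine strictMono_nat_of_lt_succ fun n => ?_
  have hq := partitionPoint_mem_Ico hs ha n
  have h := (hs _ ⟨ha.1.trans hq.1, hq.2⟩).1
  simp only [partitionPoint]
  linarith

lemma exists_mem_Ico_partitionPoint {s : ℝ → ℝ} {R a : ℝ} (hs : ∀ r ∈ Ico 0 R, s r ∈ Ioo r R)
    (hs_anti : AntitoneOn (fun r => s r - r) (Ico 0 R)) (ha : a ∈ Ico 0 R) {r : ℝ}
    (hr : r ∈ Ico a R) :
    ∃ n, r ∈ Ico (partitionPoint s a n) (partitionPoint s a (n + 1)) := by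
  classical
  have hex := exists_lt_partitionPoint hs hs_anti ha (r := r) ⟨ha.1.trans hr.1, hr.2⟩
  obtain ⟨m, hm⟩ : ∃ m, Nat.find hex = m + 1 := by
    refine Nat.exists_eq_succ_of_ne_zero fun h0 => ?_
    have := Nat.find_spec hex
    rw [h0] at this
    exact absurd this (not_lt.2 hr.1)
  refine ⟨m, not_lt.1 (Nat.find_min hex (by omega)), ?_⟩
  rw [← hm]
  exact Nat.find_spec hex

/-- Outside a set of small upper density, the value of a function at `r` is bounded by its mean
over an interval `[q, q + (s q - q) / 8]` containing `r`, up to a constant factor. -/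
lemma exists_upperDensityNear_le {s : ℝ → ℝ} {R a δ : ℝ}
    (hs : ∀ r ∈ Ico 0 R, s r ∈ Ioo r R)
    (hs_anti : AntitoneOn (fun r => s r - r) (Ico 0 R)) (ha : a ∈ Ico 0 R) (hδ : 0 < δ)
    {G : ℝ → ENNReal} (hG : Measurable G) :
    ∃ E : Set ℝ, MeasurableSet E ∧ E ⊆ Ico 0 R ∧ upperDensityNear R E ≤ ENNReal.ofReal δ ∧
      ∀ r ∈ Ico 0 R \ E, ∃ q, a ≤ q ∧ r ∈ Icc q (q + (s q - q) / 8) ∧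
        ENNReal.ofReal ((s q - q) / 8 * (δ / 2)) * G r
          ≤ ∫⁻ τ in Icc q (q + (s q - q) / 8), G τ := by
  set q := partitionPoint s a with hq
  have hqmem := partitionPoint_mem_Ico hs ha
  have hqs : ∀ n, q (n + 1) = q n + (s (q n) - q n) / 8 := fun n => rfl
  have hs' : ∀ n, s (q n) ∈ Ioo (q n) R := fun n => hs _ ⟨ha.1.trans (hqmem n).1, (hqmem n).2⟩
  have hmono := partitionPoint_strictMono hs ha
  set B : ℕ → Set ℝ := fun n => {r | ∫⁻ τ in Icc (q n) (q (n + 1)), G τ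
      < ENNReal.ofReal ((q (n + 1) - q n) * (δ / 2)) * G r} with hB
  have hBm : ∀ n, MeasurableSet (B n) := fun n =>
    measurableSet_lt measurable_const (hG.const_mul _)
  set E : Set ℝ := Ico 0 a ∪ ⋃ n, B n ∩ Ico (q n) (q (n + 1)) with hE
  have hvol : ∀ n, volume (B n ∩ Ico (q n) (q (n + 1)))
      ≤ ENNReal.ofReal ((q (n + 1) - q n) * (δ / 2)) := fun n => by
    have h1 := measure_lintegral_lt_mul_le (μ := volume.restrict (Icc (q n) (q (n + 1))))
      hG.aemeasurable (ENNReal.ofReal ((q (n + 1) - q n) * (δ / 2)))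
    rw [Measure.restrict_apply (hBm n)] at h1
    exact (measure_mono (inter_subset_inter_right _ Ico_subset_Icc_self)).trans h1
  refine ⟨E, measurableSet_Ico.union (.iUnion fun n => (hBm n).inter measurableSet_Ico), ?_, ?_, ?_⟩
  · refine union_subset (Ico_subset_Ico_right ha.2.le) (iUnion_subset fun n x hx => ?_)
    exact ⟨(ha.1.trans (hqmem n).1).trans hx.2.1, hx.2.2.trans (hqmem (n + 1)).2⟩
  · refine limsup_le_of_le (by isBoundedDefault) ?_
    filter_upwards [Ioo_mem_nhdsLT ha.2] with r hr
    obtain ⟨n, hn⟩ := exists_mem_Ico_partitionPoint hs hs_anti ha ⟨hr.1.le, hr.2⟩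
    have hsub : E ∩ Ico r R ⊆ ⋃ m, B (n + m) ∩ Ico (q (n + m)) (q (n + m + 1)) := by
      rintro x ⟨hx | hx, hxr⟩
      · exact absurd (hr.1.trans_le hxr.1) (not_lt.2 hx.2.le)
      · obtain ⟨m, hm⟩ := mem_iUnion.1 hx
        have hnm : n < m + 1 := hmono.lt_iff_lt.1 ((hn.1.trans hxr.1).trans_lt hm.2.2)
        refine mem_iUnion.2 ⟨m - n, ?_⟩
        rwa [show n + (m - n) = m by omega]
    have hsum : ∀ N, ∑ m ∈ Finset.range N, (q (n + m + 1) - q (n + m)) = q (n + N) - q n :=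
      Finset.sum_range_sub fun m => q (n + m)
    have hvol' : volume (E ∩ Ico r R) ≤ ENNReal.ofReal ((R - q n) * (δ / 2)) := by
      refine (measure_mono hsub).trans ((measure_iUnion_le _).trans ?_)
      refine ENNReal.tsum_le_of_sum_range_le fun N => ?_
      refine (Finset.sum_le_sum fun m _ => hvol (n + m)).trans ?_
      rw [← ENNReal.ofReal_sum_of_nonneg fun m _ =>
        mul_nonneg (sub_nonneg.2 (hmono (Nat.lt_add_one (n + m))).le) (by positivity),
        ← Finset.sum_mul, hsum]
      refine ENNReal.ofReal_le_ofReal ?_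
      have := (hqmem (n + N)).2
      gcongr
    refine ENNReal.div_le_of_le_mul (hvol'.trans ?_)
    rw [← ENNReal.ofReal_mul hδ.le]
    refine ENNReal.ofReal_le_ofReal ?_
    have h1 := hn.2
    have h2 := (hs' n).2
    rw [← hq, hqs] at h1
    have h3 : (R - q n) / 2 ≤ R - r := by linarith [(hqmem n).2]
    linarith [mul_le_mul_of_nonneg_left h3 hδ.le]
  · rintro r ⟨hr, hrE⟩
    have har : a ≤ r := by
      by_contra! h
      exact hrE (Or.inl ⟨hr.1, h⟩)
    obtain ⟨n, hn⟩ := exists_mem_Ico_partitionPoint hs hs_anti ha ⟨har, hr.2⟩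
    refine ⟨q n, (hqmem n).1, Ico_subset_Icc_self hn, ?_⟩
    by_contra! h
    refine hrE (Or.inr (mem_iUnion.2 ⟨n, ?_, hn⟩))
    simp only [hB, mem_ofPred_eq, hqs]
    rwa [add_sub_cancel_left]

/-! ### The estimates for measurable functions, and the reduction to them -/

/-- How a bound over an interval of the partition becomes a bound at `r`: here `h = s q - q` is the
step at the left end `q` of the interval, and `d = s r - r` is at most `h`. -/
lemma logDerivMeanLE_of_mul_le {f : ℂ → ℂ} (hm : Measurable f) {j k : ℕ}
    {r h d δ A A' : ℝ} {I : ENNReal} (hδ : 0 < δ) (hd : 0 < d) (hdh : d ≤ h) (hA : A ≤ A')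
    (hA' : 0 ≤ A') (hG : ENNReal.ofReal (h / 8 * (δ / 2)) * quotientMean f j k r ≤ I)
    (hI : I ≤ ENNReal.ofReal A) : LogDerivMeanLE f j k r (16 / δ * (A' / d)) := by
  refine logDerivMeanLE_of_quotientMean_le hm (by positivity) ?_
  have h0 : 0 < d / 8 * (δ / 2) := by positivity
  have h1 : ENNReal.ofReal (d / 8 * (δ / 2)) * quotientMean f j k r ≤ ENNReal.ofReal A' :=
    calc ENNReal.ofReal (d / 8 * (δ / 2)) * quotientMean f j k r
        ≤ ENNReal.ofReal (h / 8 * (δ / 2)) * quotientMean f j k r := by gcongr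
      _ ≤ ENNReal.ofReal A' := (hG.trans hI).trans (ENNReal.ofReal_le_ofReal hA)
  rw [show 16 / δ * (A' / d) = A' / (d / 8 * (δ / 2)) by field_simp; ring,
    ENNReal.ofReal_div_of_pos h0]
  rw [ENNReal.le_div_iff_mul_le (Or.inl (by simpa using h0)) (Or.inl ENNReal.ofReal_ne_top),
    mul_comm]
  exact h1

/-- The estimates for a measurable function. The exceptional set is constructed on `[r₂, R)`, with
`r₂` so close to `R` that `-log (s r - r)` absorbs the additive constants, and beyond a radius with
positive characteristic if there is one. -/
lemma exists_exceptionalSet_of_measurable {f : ℂ → ℂ} {R : ℝ} (hR : 0 < R) (hm : Measurable f)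
    (hf : MeromorphicOn f (ball 0 R)) {j k : ℕ} (hjk : j < k) {s : ℝ → ℝ}
    (hs : ∀ r ∈ Ico 0 R, s r ∈ Ioo r R) (hs_mono : MonotoneOn s (Ico 0 R))
    (hs_anti : AntitoneOn (fun r => s r - r) (Ico 0 R)) {δ : ℝ} (hδ : δ ∈ Ioo (0 : ℝ) 1) :
    ∃ E : Set ℝ, MeasurableSet E ∧ E ⊆ Ico 0 R ∧
      upperDensityNear R E ≤ ENNReal.ofReal δ ∧
      (∃ C : ℝ, 0 < C ∧ ∀ r ∈ Ico 0 R \ E,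
        LogDerivMeanLE f j k r (C * ((nevanlinnaT f (s r) - log (s r - r)) / (s r - r)))) ∧
      (k = 1 → j = 0 →
        (∃ C : ℝ, 0 < C ∧ ∀ r ∈ Ico 0 R \ E,
          LogDerivMeanLE f j k r (C * ((nevanlinnaT f (s r) + C) / (s r - r)))) ∧
        ((∃ r₀ ∈ Ioo 0 R, 0 < nevanlinnaT f r₀) →
          ∃ C : ℝ, 0 < C ∧ ∀ r ∈ Ico 0 R \ E,
            LogDerivMeanLE f j k r (C * (nevanlinnaT f (s r) / (s r - r))))) := by
  have hδ0 := hδ.1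
  obtain ⟨C, hC, hbd⟩ := exists_setLIntegral_quotientMean_le hm hf (half_pos hR)
    (half_lt_self hR) hjk
  obtain ⟨r₀, hr₀, hTr₀⟩ : ∃ r₀ ∈ Ioo 0 R,
      (∃ r ∈ Ioo 0 R, 0 < nevanlinnaT f r) → 0 < nevanlinnaT f r₀ := by
    by_cases h : ∃ r ∈ Ioo 0 R, 0 < nevanlinnaT f r
    · obtain ⟨r, hr, hT⟩ := h
      exact ⟨r, hr, fun _ => hT⟩
    · exact ⟨R / 2, ⟨half_pos hR, half_lt_self hR⟩, fun h' => absurd h' h⟩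
  set r₂ := max (max (R / 2) r₀) (R - exp (-(2 * C + |log R|))) with hr₂
  have h1 : R / 2 ≤ r₂ := (le_max_left _ _).trans (le_max_left _ _)
  have h2 : r₀ ≤ r₂ := (le_max_right _ _).trans (le_max_left _ _)
  have h3 : R - r₂ ≤ exp (-(2 * C + |log R|)) := by
    linarith [le_max_right (max (R / 2) r₀) (R - exp (-(2 * C + |log R|)))]
  have h4 : r₂ < R := max_lt (max_lt (half_lt_self hR) hr₀.2)
    (by linarith [exp_pos (-(2 * C + |log R|))])
  obtain ⟨E, hEm, hER, hEd, hE⟩ := exists_upperDensityNear_le hs hs_anti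
    (a := r₂) ⟨by linarith, h4⟩ hδ0 (measurable_quotientMean hm j k)
  have hkey : ∀ r ∈ Ico 0 R \ E, r₂ ≤ r ∧ 0 < s r - r ∧ ∃ q, R / 2 ≤ q ∧ 0 < s q - q ∧
      q + (s q - q) < R ∧ s r - r ≤ s q - q ∧
      nevanlinnaT f (q + (s q - q)) ≤ nevanlinnaT f (s r) ∧
      ENNReal.ofReal ((s q - q) / 8 * (δ / 2)) * quotientMean f j k r
        ≤ ∫⁻ τ in Icc q (q + (s q - q) / 8), quotientMean f j k τ := by
    intro r hr
    obtain ⟨q, haq, hrq, hqE⟩ := hE r hr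
    have hq : q ∈ Ico 0 R := ⟨by linarith, hrq.1.trans_lt hr.1.2⟩
    have hsq := hs q hq
    have hsr := hs r hr.1
    refine ⟨haq.trans hrq.1, sub_pos.2 hsr.1, q, h1.trans haq, sub_pos.2 hsq.1, by linarith [hsq.2],
      hs_anti hq hr.1 hrq.1, ?_, hqE⟩
    rw [add_sub_cancel]
    exact nevanlinnaT_mono hm hf (by linarith [hsq.1]) (hs_mono hq hr.1 hrq.1) hsr.2
  refine ⟨E, hEm, hER, hEd, ⟨16 / δ * (2 * C), by positivity, fun r hr => ?_⟩, ?_⟩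
  · obtain ⟨hr₂r, hd, q, hq, hdq, hqR, hle, hT, hG⟩ := hkey r hr
    obtain ⟨hT0, hI⟩ := hbd q (s q - q) hq hdq hqR
    have h5 : 2 * C + |log R| ≤ -log (s r - r) := by
      have := (log_le_log hd (by linarith [(hs r hr.1).2])).trans (log_le_log (sub_pos.2 h4) h3)
      rw [log_exp] at this
      linarith
    have h6 : log (R / (s q - q)) ≤ |log R| - log (s r - r) := by
      rw [log_div hR.ne' hdq.ne']
      linarith [log_le_log hd hle, le_abs_self (log R)]
    rw [mul_assoc, ← mul_div_assoc]
    have := abs_nonneg (log R)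
    refine logDerivMeanLE_of_mul_le hm hδ0 hd hle ?_ ?_ hG hI
    · rw [mul_comm 2 C, mul_assoc]
      gcongr
      linarith
    · exact mul_nonneg (by linarith) (by linarith)
  · rintro rfl rfl
    obtain ⟨K, hK, hbd'⟩ :=
      exists_setLIntegral_quotientMean_zero_one_le hm hf (half_pos hR) (half_lt_self hR)
    refine ⟨⟨16 / δ * K, by positivity, fun r hr => ?_⟩, fun hpos => ?_⟩
    · obtain ⟨hr₂r, hd, q, hq, hdq, hqR, hle, hT, hG⟩ := hkey r hr
      obtain ⟨hT0, hI⟩ := hbd' q (s q - q) hq hdq hqR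
      have hKK : K ≤ 16 / δ * K := by
        refine le_mul_of_one_le_left hK.le ?_
        rw [one_le_div hδ0]
        linarith [hδ.2]
      rw [mul_assoc, ← mul_div_assoc]
      refine logDerivMeanLE_of_mul_le hm hδ0 hd hle ?_ ?_ hG hI
      · gcongr
      · exact mul_nonneg hK.le (by linarith)
    · have hT₀ := hTr₀ hpos
      refine ⟨16 / δ * (K * (1 + K / nevanlinnaT f r₀)), by positivity, fun r hr => ?_⟩
      obtain ⟨hr₂r, hd, q, hq, hdq, hqR, hle, hT, hG⟩ := hkey r hr
      obtain ⟨hT0, hI⟩ := hbd' q (s q - q) hq hdq hqR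
      have hsr := hs r hr.1
      have h5 : nevanlinnaT f r₀ ≤ nevanlinnaT f (s r) :=
        nevanlinnaT_mono hm hf hr₀.1 (by linarith [hsr.1]) hsr.2
      have h6 : K ≤ K / nevanlinnaT f r₀ * nevanlinnaT f (s r) := by
        rw [div_mul_eq_mul_div, le_div_iff₀ hT₀]
        gcongr
      rw [mul_assoc, ← mul_div_assoc]
      refine logDerivMeanLE_of_mul_le hm hδ0 hd hle ?_ ?_ hG hI
      · rw [mul_assoc]
        gcongr
        linarith
      · have := hT₀.trans_le h5
        positivity

/-- A function meromorphic on an open set is measurable once it is extended by zero. -/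
lemma MeromorphicOn.measurable_indicator {f : ℂ → ℂ} {U : Set ℂ} (hf : MeromorphicOn f U)
    (hU : IsOpen U) : Measurable (U.indicator f) := by
  set A := {z : ℂ | AnalyticAt ℂ f z} with hA
  have hAo : IsOpen A := isOpen_analyticAt ℂ f
  have hcount : (Aᶜ ∩ U).Countable := hf.countable_compl_analyticAt_inter
  have h1 : Measurable ((A ∩ U).indicator f) := by
    classical
    rw [← piecewise_eq_indicator]
    exact ContinuousOn.measurable_piecewise
      (fun z hz => (AnalyticAt.continuousAt hz.1).continuousWithinAt) continuousOn_const
      (hAo.inter hU).measurableSet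
  refine h1.measurable_of_countable_ne (hcount.mono fun z hz => ?_)
  by_cases hzU : z ∈ U
  · refine ⟨fun hzA => hz ?_, hzU⟩
    rw [indicator_of_mem hzU, indicator_of_mem (show z ∈ A ∩ U from ⟨hzA, hzU⟩)]
  · refine absurd ?_ hz
    rw [indicator_of_notMem hzU, indicator_of_notMem fun h => hzU h.2]

lemma poleCounting_congr {f g : ℂ → ℂ} {R r : ℝ} (hf : MeromorphicOn f (ball 0 R))
    (hfg : EqOn f g (ball 0 R)) (hr : 0 < r) (hrR : r < R) :
    poleCounting f r = poleCounting g r := by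
  have hg : MeromorphicOn g (ball 0 R) := hf.congr hfg isOpen_ball
  obtain ⟨S, hS⟩ := (hf.closedBall_of_ball hrR).exists_finset_orderInt
  have hord : ∀ z, ‖z‖ ≤ r → orderInt g z = orderInt f z := fun z hz => by
    have : f =ᶠ[𝓝 z] g := hfg.eventuallyEq_of_mem
      (isOpen_ball.mem_nhds (by simpa using hz.trans_lt hrR))
    rw [orderInt, orderInt, meromorphicOrderAt_congr (this.filter_mono nhdsWithin_le_nhds)]
  rw [poleCounting_eq_sum hr (hf.closedBall_of_ball hrR) fun z hz h => (hS z).2 ⟨hz, h⟩,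
    poleCounting_eq_sum hr (hg.closedBall_of_ball hrR)
      fun z hz h => (hS z).2 ⟨hz, hord z hz ▸ h⟩, hord 0 (by simpa using hr.le)]
  congr 1
  exact Finset.sum_congr rfl fun z hz => by rw [hord z ((hS z).1 hz).1]

lemma nevanlinnaT_congr {f g : ℂ → ℂ} {R r : ℝ} (hf : MeromorphicOn f (ball 0 R))
    (hfg : EqOn f g (ball 0 R)) (hr : 0 < r) (hrR : r < R) :
    nevanlinnaT f r = nevanlinnaT g r := by
  rw [nevanlinnaT, nevanlinnaT, poleCounting_congr hf hfg hr hrR,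
    ValueDistribution.proximity_top, ValueDistribution.proximity_top]
  congr 1
  refine circleAverage_congr_sphere fun z hz => ?_
  rw [abs_of_pos hr, mem_sphere_zero_iff_norm] at hz
  rw [hfg (by simpa [hz] using hrR)]

lemma LogDerivMeanLE.congr {f g : ℂ → ℂ} {R r B : ℝ} {j k : ℕ} (hfg : EqOn f g (ball 0 R))
    (hr : 0 ≤ r) (hrR : r < R) (h : LogDerivMeanLE g j k r B) : LogDerivMeanLE f j k r B := by
  have h1 : ∀ n θ, iteratedDeriv n f (circleMap 0 r θ) = iteratedDeriv n g (circleMap 0 r θ) :=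
    fun n θ => Filter.EventuallyEq.iteratedDeriv_eq n (hfg.eventuallyEq_of_mem
      (isOpen_ball.mem_nhds (by simpa [abs_of_nonneg hr] using hrR)))
  rw [LogDerivMeanLE] at h ⊢
  simpa only [h1] using h

end

theorem mainTheorem7 (R : ℝ) (hR : 0 < R) (f : ℂ → ℂ)
    (hf : MeromorphicOn f (Metric.ball 0 R))
    (j k : ℕ) (hjk : j < k)
    -- the meromorphic function `f^{(j)}` does not vanish identically
    (hfj : ∃ z ∈ Metric.ball (0 : ℂ) R, AnalyticAt ℂ f z ∧ iteratedDeriv j f z ≠ 0)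
    (s : ℝ → ℝ)
    (hs : ∀ r ∈ Ico 0 R, s r ∈ Ioo r R)
    (hs_cont : ContinuousOn s (Ico 0 R))
    (hs_mono : MonotoneOn s (Ico 0 R))
    (hs_anti : AntitoneOn (fun r => s r - r) (Ico 0 R))
    (δ : ℝ) (hδ : δ ∈ Ioo (0 : ℝ) 1) :
    ∃ E : Set ℝ, MeasurableSet E ∧ E ⊆ Ico 0 R ∧
      upperDensityNear R E ≤ ENNReal.ofReal δ ∧
      (∃ C : ℝ, 0 < C ∧ ∀ r ∈ Ico 0 R \ E,
        LogDerivMeanLE f j k r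
          (C * ((nevanlinnaT f (s r) - Real.log (s r - r)) / (s r - r)))) ∧
      (k = 1 → j = 0 →
        (∃ C : ℝ, 0 < C ∧ ∀ r ∈ Ico 0 R \ E,
          LogDerivMeanLE f j k r (C * ((nevanlinnaT f (s r) + C) / (s r - r)))) ∧
        ((∃ r₀ ∈ Ioo 0 R, 0 < nevanlinnaT f r₀) →
          ∃ C : ℝ, 0 < C ∧ ∀ r ∈ Ico 0 R \ E,
            LogDerivMeanLE f j k r (C * (nevanlinnaT f (s r) / (s r - r))))) := by
  set F := (Metric.ball (0 : ℂ) R).indicator f with hF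
  have hfF : EqOn f F (Metric.ball 0 R) := fun z hz => (indicator_of_mem hz f).symm
  obtain ⟨E, hEm, hER, hEd, ⟨C, hC, h1⟩, h2⟩ := exists_exceptionalSet_of_measurable hR
    (hf.measurable_indicator Metric.isOpen_ball) (hf.congr hfF Metric.isOpen_ball) hjk hs hs_mono
    hs_anti hδ
  have hT : ∀ r ∈ Ioo 0 R, nevanlinnaT f r = nevanlinnaT F r := fun r hr =>
    nevanlinnaT_congr hf hfF hr.1 hr.2
  have hTs : ∀ r ∈ Ico 0 R \ E, nevanlinnaT f (s r) = nevanlinnaT F (s r) := fun r hr =>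
    hT _ ⟨hr.1.1.trans_lt (hs r hr.1).1, (hs r hr.1).2⟩
  refine ⟨E, hEm, hER, hEd, ⟨C, hC, fun r hr => ?_⟩, fun hk hj => ?_⟩
  · rw [hTs r hr]
    exact (h1 r hr).congr hfF hr.1.1 hr.1.2
  · obtain ⟨⟨K, hK, h3⟩, h4⟩ := h2 hk hj
    refine ⟨⟨K, hK, fun r hr => ?_⟩, fun ⟨r₀, hr₀, hpos⟩ => ?_⟩
    · rw [hTs r hr]
      exact (h3 r hr).congr hfF hr.1.1 hr.1.2
    · obtain ⟨L, hL, h5⟩ := h4 ⟨r₀, hr₀, hT r₀ hr₀ ▸ hpos⟩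
      refine ⟨L, hL, fun r hr => ?_⟩
      rw [hTs r hr]
      exact (h5 r hr).congr hfF hr.1.1 hr.1.2
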